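/- Write $\mathbb C^{+}=\{z:\operatorname{Im}z>0\}$. For a probability measure $\mu$ on $\mathbb R$ let $G_\mu(z)=\int_{\mathbb R}\frac{1}{z-x}\,\mu(dx)$ and $F_\mu=1/G_\mu$ on $\mathbb C^{+}$. The Voiculescu transform of $\mu$ is $\varphi_\mu(z)=F_\mu^{-1}(z)-z$ on a truncated cone $\{z: \operatorname{Im}z>M,\ |\operatorname{Re}z|<\lambda\operatorname{Im}z\}$ ($\lambda, M>0$), where $F_\mu^{-1}$ is the right inverse of $F_\mu$ with values in a truncated cone of the same kind (with other parameters) on which $F_\mu$ is injective. Suppose that $\varphi_\mu$ extends to an analytic map $\widetilde\varphi_\mu:\mathbb C^{+}\to\{z:\operatorname{Im} z\le 0\}$ (equivalently, $\mu$ is freely infinitely divisible), and write $$\widetilde\varphi_\mu(z)=b+\int_{\mathbb R}\frac{1+xz}{z-x}\,\tau(dx),\qquad z\in\mathbb C^{+},$$ with $b\in\mathbb R$ and $\tau$ a finite measure on $\mathbb R$. Then the measure $\frac{1+x^2}{x^2}\mathbf 1_{\mathbb R\setminus\{0\}}(x)\,\tau(dx)$ is called the free Lévy measure of $\mu$. Let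 $\widetilde G(z)=e^{-z^2/2}\Big[-i\sqrt{\pi/2}+\sqrt2\int_0^{z/\sqrt2}e^{t^2}\,dt\Big]$ and let $\widetilde F=1/\widetilde G$, a meromorphic function on $\mathbb C$. **Theorem.** The function $\widetilde G$ is entire and coincides on $\mathbb C^{+}$ with $G_{N(0,1)}$. There are a domain $\Omega$ with $\mathbb C^{+}\subset\Omega\subset\mathbb C$ and a function $h:(0,\infty)\to(0,\infty)$ such that 1. $\widetilde F$ is an analytic bijection from $\Omega$ onto $\mathbb C^{+}$; 2. for every $x>0$ there is exactly one point $z\in\partial\Omega$ with $\widetilde F(z)=x$, and $h(x)=-\operatorname{Im}z$ for this $z$; 3. $h$ is real analytic on $(0,\infty)$, and $h'(x)<0$ for all $x>0$; 4. the standard normal distribution $N(0,1)$ has a free Lévy measure, it is unique, and it equals $$\frac{1}{\pi x^{2}}\,h(|x|)\,\mathbf 1_{\mathbb R\setminus\{0\}}(x)\,dx .$$ -/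

import Mathlib

open MeasureTheory

noncomputable section

namespace FreeLevy

/-- The open upper half-plane `ℂ⁺`. -/
def upperHalf : Set ℂ := {z : ℂ | 0 < z.im}

/-- The Cauchy transform `G_μ(z) = ∫ 1/(z - x) μ(dx)` of a measure on `ℝ`, for `z ∈ ℂ ∖ ℝ`. -/
def cauchyTransform (μ : Measure ℝ) (z : ℂ) : ℂ := ∫ x : ℝ, 1 / (z - (x : ℂ)) ∂μ

/-- The reciprocal Cauchy transform `F_μ = 1 / G_μ`, used on `ℂ⁺`. -/
def recipCauchy (μ : Measure ℝ) (z : ℂ) : ℂ := 1 / cauchyTransform μ z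

/-- The truncated cone `Γ_{a,b} = {z ∈ ℂ⁺ : Im z > b, |Re z| < a * Im z}` (for `a, b > 0`). -/
def cone (a b : ℝ) : Set ℂ := {z : ℂ | b < z.im ∧ |z.re| < a * z.im}

/-- `φ` is, on the cone `Γ_{l,M}`, the Voiculescu transform `F_μ⁻¹(z) - z` of `μ`. Here `F_μ⁻¹`
is the right inverse of `F_μ` on `Γ_{l,M}` with values in a cone `Γ_{a,b}` on which `F_μ` is
univalent (so that `Γ_{l,M} ⊆ F_μ(Γ_{a,b})`). -/
def IsVoiculescuOn (μ : Measure ℝ) (l M : ℝ) (φ : ℂ → ℂ) : Prop :=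
  ∃ a b : ℝ, 0 < a ∧ 0 < b ∧ Set.InjOn (recipCauchy μ) (cone a b) ∧
    ∀ z ∈ cone l M, φ z + z ∈ cone a b ∧ recipCauchy μ (φ z + z) = z

/-- `φ` is the analytic extension to `ℂ⁺`, with values in `ℂ⁻ ∪ ℝ`, of the Voiculescu transform
of `μ`. (Only the values of `φ` on `ℂ⁺` matter.) -/
def IsVoiculescuExtension (μ : Measure ℝ) (φ : ℂ → ℂ) : Prop :=
  AnalyticOnNhd ℂ φ upperHalf ∧ (∀ z ∈ upperHalf, (φ z).im ≤ 0) ∧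
    ∃ l M : ℝ, 0 < l ∧ 0 < M ∧ IsVoiculescuOn μ l M φ

/-- `(b, τ)` gives the Pick-Nevanlinna representation
`φ(z) = b + ∫ (1 + x z)/(z - x) τ(dx)` on `ℂ⁺`, with `τ` a finite measure. -/
def IsPickNevanlinnaPair (φ : ℂ → ℂ) (b : ℝ) (τ : Measure ℝ) : Prop :=
  IsFiniteMeasure τ ∧
    ∀ z ∈ upperHalf, φ z = (b : ℂ) + ∫ x : ℝ, (1 + (x : ℂ) * z) / (z - (x : ℂ)) ∂τ

/-- `ν` is the free Lévy measure of `μ`: the Voiculescu transform of `μ` has an analytic extension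
to `ℂ⁺` with values in `ℂ⁻ ∪ ℝ`, and `ν(dx) = (1 + x²)/x² 1_{ℝ ∖ {0}}(x) τ(dx)`, where `(b, τ)` is
the pair in the Pick-Nevanlinna representation of this extension. -/
def IsFreeLevyMeasure (μ ν : Measure ℝ) : Prop :=
  ∃ (φ : ℂ → ℂ) (b : ℝ) (τ : Measure ℝ),
    IsVoiculescuExtension μ φ ∧ IsPickNevanlinnaPair φ b τ ∧
      ν = (τ.restrict {0}ᶜ).withDensity (fun x : ℝ => ENNReal.ofReal ((1 + x ^ 2) / x ^ 2))

/-- `Ω` is a domain containing `ℂ⁺`, and `Φ` is an extension of `F_μ` that is an analytic bijection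
from `Ω` onto `ℂ⁺`. (For given `μ`, there is at most one such `Ω`.) -/
def IsUnivalentExtension (μ : Measure ℝ) (Ω : Set ℂ) (Φ : ℂ → ℂ) : Prop :=
  IsOpen Ω ∧ IsConnected Ω ∧ upperHalf ⊆ Ω ∧ Set.EqOn Φ (recipCauchy μ) upperHalf ∧
    AnalyticOnNhd ℂ Φ Ω ∧ Set.BijOn Φ Ω upperHalf

/-- The entire function
`G(z) = exp(-z²/2) * (-i √(π/2) + √2 ∫_0^{z/√2} exp(t²) dt)`, which is the analytic continuation to
`ℂ` of the Cauchy transform of `N(0,1)` on `ℂ⁺`; the integral is taken along the segment from `0`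
to `z/√2`, parametrized by `t = s z/√2`, `0 ≤ s ≤ 1`. -/
def gaussG (z : ℂ) : ℂ :=
  Complex.exp (-z ^ 2 / 2) *
    (-Complex.I * (Real.sqrt (Real.pi / 2) : ℂ) +
      (Real.sqrt 2 : ℂ) *
        ∫ s in (0 : ℝ)..1, Complex.exp (((s : ℂ) * (z / (Real.sqrt 2 : ℂ))) ^ 2) *
          (z / (Real.sqrt 2 : ℂ)))

/-- The meromorphic continuation `1 / G` of the reciprocal Cauchy transform of `N(0,1)`; its value
at a pole is, by convention, `0`. -/
def gaussF (z : ℂ) : ℂ := 1 / gaussG z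

end FreeLevy

end

/-!
Write `G` for `gaussG` and `F = 1 / G`. The theorem rests on the two facts that `G` solves
`G' = 1 - z G` (`hasDerivAt_gaussG`) and that `Im F(z) > Im z` on `ℂ⁺` (`inv_gaussG_im_lt`, a strict
Cauchy-Schwarz inequality), while `F` takes no real values on `ℝ`. A critical point of `G` is a zero
of `1 - z G`, that is, a fixed point of `F`; hence `G` has no critical point over the closed upper
half-plane punctured at `0`, anywhere in `ℂ` (`one_sub_mul_gaussG_ne_zero`).

So `F` is a local homeomorphism over this simply connected set, and the question is whether paths
lift. In the variable `v = 1 / w` a lift `g` of a segment `γ` satisfies `g' = γ' / (1 - g γ)`, which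
keeps `g` bounded since `γ` stays away from `0` (`norm_lift_le`, `exists_segment_lift`). The lifts
of the segments issuing from `G(i)` form a continuous inverse `gaussInv` of `F`, defined on `ℂ⁺` and
on `ℝ ∖ {0}`, with `F⁻¹ ∘ F = id` on `ℂ⁺` (`exists_inverse_function`). Its image of `ℂ⁺` is `Ω`, and
its boundary values on `ℝ ∖ {0}` are the boundary points of `Ω` with nonzero real image
(`isUnivalentExtension_gaussF`, `frontier_gaussDomain_iff`).

Put `φ(w) = F⁻¹(w) - w` and `h = -Im φ` on `ℝ ∖ {0}`. Then `Im φ ≤ 0`, because `Im F(z) > Im z` on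
`ℂ⁺`, and `h > 0`, because `F` is not real on `ℂ⁺ ∪ ℝ`. The differential equation for `G` turns into
`φ' = 1 / (w φ) - 1`, which on the real axis gives `h' = -h / (x |φ|²)` (`hasDerivAt_levyH`), hence
`h' < 0` for `x > 0`, and which bounds `φ` by a logarithm at `0` (`norm_gaussVoiculescu_le_log`).
Hence `Im φ` is the Poisson integral of its boundary values `-h`
(`integral_poisson_mul_gaussVoiculescu`), and the measure in the Pick-Nevanlinna representation is
`h(x) / (π (1 + x²)) dx` (`exists_isPickNevanlinnaPair`). The representation is unique since a
finite measure is determined by its Cauchy transform (`eq_of_cauchyTransform_eqOn`), and the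
extension of the Voiculescu transform is unique by the identity theorem.
-/

noncomputable section

open Complex Filter Set ProbabilityTheory
open scoped Topology ComplexConjugate

namespace FreeLevy

/-! ### Cauchy transforms -/

lemma notMem_algebraMap_image {z : ℂ} (hz : z.im ≠ 0) (s : Set ℝ) : z ∉ algebraMap ℝ ℂ '' s := by
  rintro ⟨x, -, rfl⟩
  simp at hz

lemma sub_ofReal_ne_zero {z : ℂ} (hz : z.im ≠ 0) (x : ℝ) : z - x ≠ 0 := by
  intro h
  apply hz
  have := congrArg Complex.im h
  simpa using this

lemma resolvent_eq (z : ℂ) (x : ℝ) : resolvent z x = -(1 / (z - x)) := by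
  rw [resolvent, Ring.inverse_eq_inv', ← neg_sub, inv_neg, one_div]
  rfl

lemma cauchyTransform_eq (μ : Measure ℝ) (z : ℂ) :
    cauchyTransform μ z = -resolventTransform μ z := by
  simp [cauchyTransform, resolventTransform_apply, resolvent_eq, integral_neg]

lemma integrable_cauchyKernel (μ : Measure ℝ) [IsFiniteMeasure μ] {z : ℂ} (hz : z.im ≠ 0) :
    Integrable (fun x : ℝ => 1 / (z - x)) μ := by
  have := (integrable_resolvent (μ := μ) (notMem_algebraMap_image hz _)).neg
  refine this.congr (ae_of_all _ fun x => ?_)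
  simp [resolvent_eq]

lemma hasDerivAt_cauchyTransform (μ : Measure ℝ) [IsFiniteMeasure μ] {z : ℂ} (hz : z.im ≠ 0) :
    HasDerivAt (cauchyTransform μ) (-∫ x : ℝ, (1 / (z - x)) ^ 2 ∂μ) z := by
  have := (hasDerivAt_resolventTransform (μ := μ) z (notMem_algebraMap_image hz _)).neg
  have h2 : cauchyTransform μ = -resolventTransform μ := by
    ext w; simp [cauchyTransform_eq]
  rw [h2]
  refine this.congr_deriv ?_
  simp [resolvent_eq]

lemma analyticOnNhd_cauchyTransform (μ : Measure ℝ) [IsFiniteMeasure μ] :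
    AnalyticOnNhd ℂ (cauchyTransform μ) upperHalf := by
  apply DifferentiableOn.analyticOnNhd
  · intro z hz
    exact (hasDerivAt_cauchyTransform μ (ne_of_gt hz)).differentiableAt.differentiableWithinAt
  · exact isOpen_lt continuous_const continuous_im

lemma isOpen_upperHalf : IsOpen upperHalf := isOpen_lt continuous_const continuous_im

lemma convex_upperHalf : Convex ℝ upperHalf := convex_halfSpace_im_gt 0

lemma isPreconnected_upperHalf : IsPreconnected upperHalf := convex_upperHalf.isPreconnected

lemma norm_cauchyKernel_le {z : ℂ} (hz : 0 < z.im) (x : ℝ) : ‖1 / (z - x)‖ ≤ 1 / z.im := by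
  rw [norm_div, norm_one]
  apply one_div_le_one_div_of_le hz
  have := abs_im_le_norm (z - x)
  simp only [sub_im, ofReal_im, sub_zero] at this
  exact (le_abs_self _).trans this

/-! ### The entire function `G` and its differential equation -/

/-- The entire function `ζ ↦ ∫₀^ζ exp(t²) dt`, the integral being along a segment, is a primitive
of `exp(ζ²)`. -/
lemma hasDerivAt_segment_integral (ζ : ℂ) :
    HasDerivAt (fun ζ : ℂ => ∫ s in (0 : ℝ)..1, exp (((s : ℂ) * ζ) ^ 2) * ζ) (exp (ζ ^ 2)) ζ := by
  have hd : DifferentiableOn ℂ (fun z : ℂ => exp (z ^ 2)) (Metric.ball 0 (‖ζ‖ + 1)) := by fun_prop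
  obtain ⟨P, hP⟩ := hd.isExactOn_ball
  have key : ∀ w ∈ Metric.ball (0 : ℂ) (‖ζ‖ + 1),
      ∫ s in (0 : ℝ)..1, exp (((s : ℂ) * w) ^ 2) * w = P w - P 0 := by
    intro w hw
    have : ∀ s ∈ uIcc (0 : ℝ) 1, HasDerivAt (fun s : ℝ => P ((s : ℂ) * w))
        (exp (((s : ℂ) * w) ^ 2) * w) s := by
      intro s hs
      rw [uIcc_of_le zero_le_one] at hs
      have hmem : (s : ℂ) * w ∈ Metric.ball (0 : ℂ) (‖ζ‖ + 1) := by
        rw [mem_ball_zero_iff] at hw ⊢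
        rw [norm_mul, norm_real, Real.norm_of_nonneg hs.1]
        nlinarith [hs.2, norm_nonneg w]
      have h1 : HasDerivAt (fun s : ℝ => (s : ℂ) * w) (1 * w) s :=
        (ofRealCLM.hasDerivAt (x := s)).mul_const w
      refine ((hP _ hmem).comp s h1).congr_deriv ?_
      rw [one_mul]
    rw [intervalIntegral.integral_eq_sub_of_hasDerivAt this]
    · simp
    · apply Continuous.intervalIntegrable; fun_prop
  have hmem : ζ ∈ Metric.ball (0 : ℂ) (‖ζ‖ + 1) := by simp
  have := (hP ζ hmem).sub_const (P 0)
  refine this.congr_of_eventuallyEq ?_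
  filter_upwards [Metric.isOpen_ball.mem_nhds hmem] with w hw using key w hw

/-- The differential equation `G' = 1 - z G`, from which everything about `G` on and below the real
axis is derived. -/
lemma hasDerivAt_gaussG (z : ℂ) : HasDerivAt gaussG (1 - z * gaussG z) z := by
  have hs : ((Real.sqrt 2 : ℝ) : ℂ) ^ 2 = 2 := by
    rw [← ofReal_pow, Real.sq_sqrt (by norm_num)]; norm_num
  have hs0 : ((Real.sqrt 2 : ℝ) : ℂ) ≠ 0 := by
    intro h; rw [h] at hs; norm_num at hs
  have h1 : HasDerivAt (fun z : ℂ => z / (Real.sqrt 2 : ℂ)) (1 / (Real.sqrt 2 : ℂ)) z :=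
    (hasDerivAt_id z).div_const _
  have h2 := ((hasDerivAt_segment_integral (z / (Real.sqrt 2 : ℂ))).comp z h1).const_mul
    (Real.sqrt 2 : ℂ)
  have h3 := h2.const_add (-Complex.I * (Real.sqrt (Real.pi / 2) : ℂ))
  have h4 : HasDerivAt (fun z : ℂ => exp (-z ^ 2 / 2)) (exp (-z ^ 2 / 2) * (-z)) z := by
    have : HasDerivAt (fun z : ℂ => -z ^ 2 / 2) (-z) z := by
      have := ((hasDerivAt_id z).pow 2).neg.div_const 2
      refine this.congr_deriv ?_
      simp only [id, Nat.cast_ofNat]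
      ring
    exact this.cexp
  have h5 := h4.mul h3
  have he : exp (-z ^ 2 / 2) * exp ((z / (Real.sqrt 2 : ℂ)) ^ 2) = 1 := by
    rw [← exp_add, div_pow, hs]
    ring_nf
    exact exp_zero
  refine h5.congr_deriv ?_
  simp only [gaussG, Function.comp_apply]
  linear_combination he + (exp (-z ^ 2 / 2) * exp ((z / (Real.sqrt 2 : ℂ)) ^ 2)) *
    (mul_one_div_cancel hs0)

lemma differentiable_gaussG : Differentiable ℂ gaussG :=
  fun z => (hasDerivAt_gaussG z).differentiableAt

lemma continuous_gaussG : Continuous gaussG := differentiable_gaussG.continuous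

lemma analyticOnNhd_gaussG : AnalyticOnNhd ℂ gaussG univ :=
  differentiable_gaussG.differentiableOn.analyticOnNhd isOpen_univ

lemma conj_segment_integral (ζ : ℂ) :
    conj (∫ s in (0 : ℝ)..1, exp (((s : ℂ) * ζ) ^ 2) * ζ) =
      ∫ s in (0 : ℝ)..1, exp (((s : ℂ) * conj ζ) ^ 2) * conj ζ := by
  rw [intervalIntegral.integral_of_le zero_le_one, intervalIntegral.integral_of_le zero_le_one,
    ← integral_conj]
  congr 1; ext s
  simp [← exp_conj]

/-- `G` is symmetric under reflection in the imaginary axis. -/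
lemma gaussG_neg_conj (z : ℂ) : gaussG (-conj z) = -conj (gaussG z) := by
  have h := conj_segment_integral (z / (Real.sqrt 2 : ℂ))
  simp only [map_div₀, conj_ofReal] at h
  simp only [gaussG, map_mul, map_add, map_neg, conj_ofReal, conj_I, h, ← exp_conj, map_div₀,
    map_pow, map_ofNat]
  simp only [neg_sq, neg_div, mul_neg, intervalIntegral.integral_neg]
  ring

/-- The density of `N(0,1)` is visible in the boundary values of `G`. -/
lemma gaussG_ofReal_im (x : ℝ) :
    (gaussG x).im = -(Real.exp (-x ^ 2 / 2) * Real.sqrt (Real.pi / 2)) := by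
  have h : ∫ s in (0 : ℝ)..1, exp (((s : ℂ) * ((x : ℂ) / (Real.sqrt 2 : ℂ))) ^ 2) *
      ((x : ℂ) / (Real.sqrt 2 : ℂ)) =
      ((∫ s in (0 : ℝ)..1,
        Real.exp ((s * (x / Real.sqrt 2)) ^ 2) * (x / Real.sqrt 2) : ℝ) : ℂ) := by
    rw [← intervalIntegral.integral_ofReal]
    congr 1; ext s; push_cast; rfl
  rw [gaussG, h]
  have h2 : exp (-(x : ℂ) ^ 2 / 2) = ((Real.exp (-x ^ 2 / 2) : ℝ) : ℂ) := by push_cast; rfl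
  rw [h2, im_ofReal_mul]
  simp

lemma hasDerivAt_gaussianPDFReal (x : ℝ) :
    HasDerivAt (gaussianPDFReal 0 1) (-x * gaussianPDFReal 0 1 x) x := by
  have h1 : HasDerivAt (fun x : ℝ => -(x - 0) ^ 2 / (2 * ((1 : NNReal) : ℝ))) (-x) x := by
    have := (((hasDerivAt_id x).sub_const 0).pow 2).neg.div_const (2 * ((1 : NNReal) : ℝ))
    refine this.congr_deriv ?_
    simp only [id, NNReal.coe_one]
    push_cast
    ring
  have := h1.exp.const_mul (Real.sqrt (2 * Real.pi * ((1 : NNReal) : ℝ)))⁻¹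
  refine this.congr_deriv ?_
  rw [gaussianPDFReal_def]
  ring

/-- Gaussian integration by parts, applied to the Cauchy kernel. -/
lemma integral_sq_cauchyKernel_gaussianReal {z : ℂ} (hz : 0 < z.im) :
    -∫ x : ℝ, (1 / (z - x)) ^ 2 ∂(gaussianReal 0 1) =
      1 - z * cauchyTransform (gaussianReal 0 1) z := by
  have hne := sub_ofReal_ne_zero hz.ne'
  have hcont : Continuous fun x : ℝ => 1 / (z - x) :=
    continuous_const.div (by fun_prop) hne
  have hb := norm_cauchyKernel_le hz
  have hp : Integrable (fun x : ℝ => (gaussianPDFReal 0 1 x : ℂ)) :=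
    (integrable_gaussianPDFReal 0 1).ofReal
  -- the derivative of `p(x)/(z-x)` integrates to `0`
  have hd : ∀ x : ℝ, HasDerivAt (fun x : ℝ => (gaussianPDFReal 0 1 x : ℂ) * (1 / (z - x)))
      ((gaussianPDFReal 0 1 x : ℂ) * ((1 / (z - x)) ^ 2 + 1 - z * (1 / (z - x)))) x := by
    intro x
    have h1 := (hasDerivAt_gaussianPDFReal x).ofReal_comp
    have h2 : HasDerivAt (fun x : ℝ => 1 / (z - x)) ((1 / (z - x)) ^ 2) x := by
      have h3 : HasDerivAt (fun x : ℝ => z - (x : ℂ)) (-1) x :=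
        (ofRealCLM.hasDerivAt (x := x)).const_sub z
      have := h3.inv (hne x)
      simp only [one_div]
      refine this.congr_deriv ?_
      field_simp
    refine (h1.mul h2).congr_deriv ?_
    push_cast
    have := hne x
    field_simp
    ring
  have hI1 : Integrable (fun x : ℝ => (gaussianPDFReal 0 1 x : ℂ) * (1 / (z - x))) :=
    hp.mul_bdd (c := 1 / z.im) hcont.aestronglyMeasurable (ae_of_all _ hb)
  have hI2 : Integrable (fun x : ℝ => (gaussianPDFReal 0 1 x : ℂ) * (1 / (z - x)) ^ 2) := by
    refine hp.mul_bdd (c := (1 / z.im) ^ 2) (hcont.pow 2).aestronglyMeasurable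
      (ae_of_all _ fun x => ?_)
    rw [norm_pow]
    exact pow_le_pow_left₀ (norm_nonneg _) (hb x) 2
  have hI3 := (hI2.add hp).sub (hI1.const_mul z)
  have h0 := integral_eq_zero_of_hasDerivAt_of_integrable hd
    (hI3.congr (ae_of_all _ fun x => by simp only [Pi.add_apply, Pi.sub_apply]; ring)) hI1
  have h1 : ∫ x : ℝ, (gaussianPDFReal 0 1 x : ℂ) = 1 := by
    exact (integral_ofReal (𝕜 := ℂ) (f := gaussianPDFReal 0 1)).trans
      (by rw [integral_gaussianPDFReal_eq_one 0 one_ne_zero]; simp)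
  have hsplit : ∫ x : ℝ, (gaussianPDFReal 0 1 x : ℂ) * ((1 / (z - x)) ^ 2 + 1 - z * (1 / (z - x))) =
      (∫ x : ℝ, (gaussianPDFReal 0 1 x : ℂ) * (1 / (z - x)) ^ 2) + 1 -
        z * ∫ x : ℝ, (gaussianPDFReal 0 1 x : ℂ) * (1 / (z - x)) := by
    have h2 := integral_sub (hI2.add hp) (hI1.const_mul z)
    have h3 := integral_add hI2 hp
    simp only [Pi.add_apply] at h2
    rw [h3, h1, integral_const_mul] at h2
    rw [← h2]
    congr 1; ext x; ring
  rw [hsplit] at h0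
  rw [cauchyTransform, integral_gaussianReal_eq_integral_smul one_ne_zero,
    integral_gaussianReal_eq_integral_smul one_ne_zero]
  simp only [real_smul]
  linear_combination -h0

lemma norm_cauchyTransform_le (μ : Measure ℝ) [IsProbabilityMeasure μ] {z : ℂ} (hz : 0 < z.im) :
    ‖cauchyTransform μ z‖ ≤ 1 / z.im := by
  simpa [cauchyTransform] using
    norm_integral_le_of_norm_le_const (ae_of_all μ (norm_cauchyKernel_le hz))

lemma gaussG_I_mul (y : ℝ) :
    gaussG (I * y) = exp ((y : ℂ) ^ 2 / 2) *
      (-I * (Real.sqrt (Real.pi / 2) : ℂ) +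
        I * (∫ t in (0 : ℝ)..y, Real.exp (-(1 / 2) * t ^ 2) : ℝ)) := by
  have hs : ((Real.sqrt 2 : ℝ) : ℂ) ^ 2 = 2 := by
    rw [← ofReal_pow, Real.sq_sqrt (by norm_num)]; norm_num
  have hs0 : ((Real.sqrt 2 : ℝ) : ℂ) ≠ 0 := by
    intro h; rw [h] at hs; norm_num at hs
  have h1 : (∫ t in (0 : ℝ)..y, Real.exp (-(1 / 2) * t ^ 2)) =
      ∫ s in (0 : ℝ)..1, Real.exp (-(1 / 2) * (s * y) ^ 2) * y := by
    have := intervalIntegral.smul_integral_comp_mul_right (a := 0) (b := 1)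
      (fun t : ℝ => Real.exp (-(1 / 2) * t ^ 2)) y
    rw [zero_mul, one_mul] at this
    rw [← this, smul_eq_mul, ← intervalIntegral.integral_const_mul]
    congr 1; ext s; ring
  rw [h1, gaussG, ← intervalIntegral.integral_ofReal, ← intervalIntegral.integral_const_mul,
    ← intervalIntegral.integral_const_mul]
  congr 2
  · congr 1; rw [mul_pow, I_sq]; ring
  · congr 1; ext s
    push_cast
    have : ((s : ℂ) * (I * y / (Real.sqrt 2 : ℂ))) ^ 2 = -(1 / 2) * ((s : ℂ) * y) ^ 2 := by
      rw [mul_pow, div_pow, mul_pow, hs, I_sq]; ring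
    rw [this]
    field_simp

/-- The continuation `gaussG` agrees with the Cauchy transform of `N(0,1)` on `ℂ⁺`: both solve
`G' = 1 - z G`, so they differ by a multiple of `exp(-z²/2)`, which must vanish because it would be
unbounded along `iℝ₊`. -/
lemma gaussG_eqOn_cauchyTransform :
    EqOn gaussG (cauchyTransform (gaussianReal 0 1)) upperHalf := by
  set C := cauchyTransform (gaussianReal 0 1)
  have hd : ∀ z ∈ upperHalf, HasDerivAt (fun z => (gaussG z - C z) * exp (z ^ 2 / 2)) 0 z := by
    intro z hz
    have h1 := hasDerivAt_cauchyTransform (gaussianReal 0 1) (ne_of_gt hz)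
    rw [integral_sq_cauchyKernel_gaussianReal hz] at h1
    have h2 : HasDerivAt (fun z : ℂ => z ^ 2 / 2) z z := by
      refine (((hasDerivAt_id z).pow 2).div_const 2).congr_deriv ?_
      simp
    refine (((hasDerivAt_gaussG z).sub h1).mul h2.cexp).congr_deriv ?_
    simp only [Pi.sub_apply]
    ring
  obtain ⟨c, hc⟩ := isOpen_upperHalf.exists_is_const_of_deriv_eq_zero isPreconnected_upperHalf
    (fun z hz => (hd z hz).differentiableAt.differentiableWithinAt) (fun z hz => (hd z hz).deriv)
  have hc0 : c = 0 := by
    -- along `iℝ₊` both terms of `(G - C) exp(z²/2)` tend to `0`: a Gaussian tail integral, and a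
    -- bounded function times `exp(-y²/2)`
    have hlim1 : Tendsto (fun y : ℝ => -I * (Real.sqrt (Real.pi / 2) : ℂ) +
        I * (∫ t in (0 : ℝ)..y, Real.exp (-(1 / 2) * t ^ 2) : ℝ)) atTop (𝓝 0) := by
      have h1 : Tendsto (fun y : ℝ => ∫ t in (0 : ℝ)..y, Real.exp (-(1 / 2) * t ^ 2)) atTop
          (𝓝 (Real.sqrt (Real.pi / 2))) := by
        have := intervalIntegral_tendsto_integral_Ioi 0
          (integrable_exp_neg_mul_sq (b := 1 / 2) (by norm_num)).integrableOn tendsto_id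
        rw [integral_gaussian_Ioi] at this
        have h4 : Real.sqrt (Real.pi / (1 / 2)) / 2 = Real.sqrt (Real.pi / 2) := by
          have h5 : Real.pi / (1 / 2) = 2 ^ 2 * (Real.pi / 2) := by ring
          rw [h5, Real.sqrt_mul (by positivity), Real.sqrt_sq (by norm_num)]
          ring
        rwa [h4] at this
      have h2 := ((continuous_ofReal.tendsto _).comp h1).const_mul I |>.const_add
        (-I * (Real.sqrt (Real.pi / 2) : ℂ))
      refine h2.trans (by simp)
    have hlim2 : Tendsto (fun y : ℝ => C (I * y) * exp (-(y : ℂ) ^ 2 / 2)) atTop (𝓝 0) := by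
      rw [tendsto_zero_iff_norm_tendsto_zero]
      refine squeeze_zero' (Eventually.of_forall fun _ => norm_nonneg _)
        (g := fun y : ℝ => 1 / y) ?_
        (by simpa using tendsto_inv_atTop_zero (𝕜 := ℝ))
      filter_upwards [eventually_gt_atTop 0] with y hy
      have h1 := norm_cauchyTransform_le (gaussianReal 0 1) (z := I * y) (by simpa using hy)
      have h2 : ‖exp (-(y : ℂ) ^ 2 / 2)‖ ≤ 1 := by
        have : -(y : ℂ) ^ 2 / 2 = ((-y ^ 2 / 2 : ℝ) : ℂ) := by push_cast; ring
        rw [this, norm_exp_ofReal]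
        exact Real.exp_le_one_iff.2 (by nlinarith)
      have h3 : (I * (y : ℂ)).im = y := by simp
      rw [h3] at h1
      rw [norm_mul]
      exact (mul_le_of_le_one_right (norm_nonneg _) h2).trans h1
    have hlim := hlim1.sub hlim2
    rw [sub_zero] at hlim
    refine tendsto_nhds_unique (tendsto_const_nhds.congr' ?_) hlim
    filter_upwards [eventually_gt_atTop 0] with y hy
    rw [← hc (I * y) (by simpa [upperHalf] using hy), gaussG_I_mul, sub_mul]
    have e1 : (I * (y : ℂ)) ^ 2 / 2 = -((y : ℂ) ^ 2 / 2) := by rw [mul_pow, I_sq]; ring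
    have e2 : exp ((y : ℂ) ^ 2 / 2) * exp (-((y : ℂ) ^ 2 / 2)) = 1 := by
      rw [← exp_add, add_neg_cancel, exp_zero]
    rw [e1, neg_div]
    linear_combination (-I * (Real.sqrt (Real.pi / 2) : ℂ) +
        I * (∫ t in (0 : ℝ)..y, Real.exp (-(1 / 2) * t ^ 2) : ℝ)) * e2
  intro z hz
  have := hc z hz
  rw [hc0, mul_eq_zero, or_iff_left (exp_ne_zero _)] at this
  exact sub_eq_zero.1 this

/-! ### Half-plane estimates for `1 / G` -/

lemma integrable_norm_sq_cauchyKernel (μ : Measure ℝ) [IsFiniteMeasure μ] {z : ℂ}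
    (hz : 0 < z.im) : Integrable (fun x : ℝ => ‖1 / (z - x)‖ ^ 2) μ := by
  refine Integrable.of_bound (C := (1 / z.im) ^ 2) ?_ (ae_of_all _ fun x => ?_)
  · exact (integrable_cauchyKernel μ hz.ne').aestronglyMeasurable.norm.pow 2
  · rw [Real.norm_of_nonneg (by positivity)]
    exact pow_le_pow_left₀ (norm_nonneg _) (norm_cauchyKernel_le hz x) 2

lemma cauchyTransform_im (μ : Measure ℝ) [IsFiniteMeasure μ] {z : ℂ} (hz : 0 < z.im) :
    (cauchyTransform μ z).im = -(z.im * ∫ x : ℝ, ‖1 / (z - x)‖ ^ 2 ∂μ) := by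
  rw [cauchyTransform, ← integral_const_mul, ← integral_neg]
  have := integral_im (𝕜 := ℂ) (integrable_cauchyKernel μ hz.ne')
  refine Eq.trans this.symm (integral_congr_ae (ae_of_all _ fun x => ?_))
  simp only [one_div, RCLike.im_to_complex, inv_im, sub_im, ofReal_im, sub_zero, norm_inv, inv_pow,
    normSq_eq_norm_sq]
  ring

/-- The strict Cauchy-Schwarz inequality for the Cauchy kernel, which is not almost everywhere
constant for a measure without atoms. -/
lemma norm_sq_cauchyTransform_lt (μ : Measure ℝ) [IsProbabilityMeasure μ] [NullSingletonClass μ]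
    {z : ℂ} (hz : 0 < z.im) :
    ‖cauchyTransform μ z‖ ^ 2 < ∫ x : ℝ, ‖1 / (z - x)‖ ^ 2 ∂μ := by
  set c := cauchyTransform μ z with hc
  have hi := integrable_cauchyKernel μ hz.ne'
  have hi2 := integrable_norm_sq_cauchyKernel μ hz
  have hexp : ∀ x : ℝ, ‖1 / (z - x) - c‖ ^ 2 =
      ‖1 / (z - x)‖ ^ 2 - 2 * (conj c * (1 / (z - x))).re + ‖c‖ ^ 2 := by
    intro x
    rw [← normSq_eq_norm_sq, ← normSq_eq_norm_sq, ← normSq_eq_norm_sq, normSq_sub]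
    rw [mul_comm (conj c)]
    ring
  have hire : Integrable (fun x : ℝ => (conj c * (1 / (z - x))).re) μ := (hi.const_mul _).re
  have hint : Integrable (fun x : ℝ => ‖1 / (z - x) - c‖ ^ 2) μ := by
    simp_rw [hexp]
    exact (hi2.sub (hire.const_mul 2)).add (integrable_const _)
  have hval : ∫ x : ℝ, ‖1 / (z - x) - c‖ ^ 2 ∂μ = ∫ x : ℝ, ‖1 / (z - x)‖ ^ 2 ∂μ - ‖c‖ ^ 2 := by
    simp_rw [hexp]
    have h2 := integral_add (hi2.sub (hire.const_mul 2)) (integrable_const (‖c‖ ^ 2))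
    have h3 := integral_sub hi2 (hire.const_mul 2)
    simp only [Pi.sub_apply] at h2
    rw [h2, h3, integral_const_mul]
    have h1 : ∫ x : ℝ, (conj c * (1 / (z - x))).re ∂μ = ‖c‖ ^ 2 := by
      have := integral_re (𝕜 := ℂ) (hi.const_mul (conj c))
      refine Eq.trans this ?_
      rw [integral_const_mul]
      change (conj c * c).re = _
      rw [← normSq_eq_conj_mul_self, ofReal_re, normSq_eq_norm_sq]
    rw [h1]; simp; ring
  -- the kernel is injective, so it takes the value `c` on a null set at most
  have hpos : 0 < ∫ x : ℝ, ‖1 / (z - x) - c‖ ^ 2 ∂μ := by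
    refine lt_of_le_of_ne (integral_nonneg fun x => by positivity) fun h0 => ?_
    have h1 := (integral_eq_zero_iff_of_nonneg (fun x => by positivity) hint).1 h0.symm
    have hsub : {x : ℝ | 1 / (z - x) = c}.Subsingleton := by
      intro x hx y hy
      have := (hx : 1 / (z - x) = c).trans (hy : 1 / (z - y) = c).symm
      simp only [one_div, inv_inj, sub_right_inj, ofReal_inj] at this
      exact this
    have h2 : ∀ᵐ x ∂μ, x ∈ {x : ℝ | 1 / (z - x) = c} := by
      filter_upwards [h1] with x hx
      simpa [sub_eq_zero] using hx
    have h3 := hsub.measure_zero μ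
    have h4 : μ univ = 0 := by
      rw [← nonpos_iff_eq_zero, ← add_zero (0 : ENNReal)]
      have h5 : μ {x : ℝ | 1 / (z - x) = c}ᶜ = 0 := h2
      calc μ univ = μ ({x : ℝ | 1 / (z - x) = c} ∪ {x : ℝ | 1 / (z - x) = c}ᶜ) := by
            rw [union_compl_self]
        _ ≤ _ := measure_union_le _ _
        _ = _ := by rw [h3, h5]
    simp at h4
  linarith

instance : NullSingletonClass (gaussianReal 0 1) := nullSingletonClass_gaussianReal one_ne_zero

/-- On `ℂ⁺` the imaginary part strictly increases under `z ↦ 1 / G(z)`. -/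
lemma im_mul_norm_sq_gaussG_lt {z : ℂ} (hz : 0 < z.im) :
    z.im * ‖gaussG z‖ ^ 2 < -(gaussG z).im := by
  rw [gaussG_eqOn_cauchyTransform hz, cauchyTransform_im _ hz, neg_neg]
  exact mul_lt_mul_of_pos_left (norm_sq_cauchyTransform_lt _ hz) hz

lemma gaussG_im_neg {z : ℂ} (hz : 0 ≤ z.im) : (gaussG z).im < 0 := by
  rcases hz.eq_or_lt with h | h
  · have : z = (z.re : ℂ) := Complex.ext rfl (by simp [← h])
    rw [this, gaussG_ofReal_im]
    have := Real.exp_pos (-z.re ^ 2 / 2)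
    have : 0 < Real.sqrt (Real.pi / 2) := Real.sqrt_pos.2 (by positivity)
    rw [neg_lt_zero]; positivity
  · have := im_mul_norm_sq_gaussG_lt h
    have : 0 ≤ z.im * ‖gaussG z‖ ^ 2 := by positivity
    linarith

lemma gaussG_ne_zero {z : ℂ} (hz : 0 ≤ z.im) : gaussG z ≠ 0 := by
  intro h
  have := gaussG_im_neg hz
  simp [h] at this

lemma inv_gaussG_im_lt {z : ℂ} (hz : 0 < z.im) : z.im < ((gaussG z)⁻¹).im := by
  have h0 := gaussG_ne_zero hz.le
  rw [inv_im, lt_div_iff₀ (normSq_pos.2 h0), normSq_eq_norm_sq]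
  exact im_mul_norm_sq_gaussG_lt hz

/-- The classical estimate `|F(z) - z| ≤ σ² / Im z` for the reciprocal Cauchy transform. -/
lemma norm_inv_gaussG_sub_le {z : ℂ} (hz : 0 < z.im) : ‖(gaussG z)⁻¹ - z‖ ≤ 1 / z.im := by
  have h0 := gaussG_ne_zero hz.le
  set J := ∫ x : ℝ, ‖1 / (z - x)‖ ^ 2 ∂(gaussianReal 0 1)
  have h1 : ‖1 - z * gaussG z‖ ≤ J := by
    rw [gaussG_eqOn_cauchyTransform hz, ← integral_sq_cauchyKernel_gaussianReal hz, norm_neg]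
    refine (norm_integral_le_integral_norm _).trans_eq ?_
    simp [J]
  have h2 : z.im * J ≤ ‖gaussG z‖ := by
    have h3 : (gaussG z).im = -(z.im * J) := by
      rw [gaussG_eqOn_cauchyTransform hz, cauchyTransform_im _ hz]
    have := abs_im_le_norm (gaussG z)
    rw [h3, abs_neg] at this
    exact (le_abs_self _).trans this
  have h4 : (gaussG z)⁻¹ - z = (1 - z * gaussG z) / gaussG z := by field_simp
  rw [h4, norm_div, div_le_div_iff₀ (norm_pos_iff.2 h0) hz, one_mul]
  nlinarith

/-- The closed upper half-plane without the origin, on which the inverse of `F = 1 / G` lives. -/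
def closedUpperHalf : Set ℂ := {w : ℂ | 0 ≤ w.im ∧ w ≠ 0}

lemma upperHalf_subset_closedUpperHalf : upperHalf ⊆ closedUpperHalf := by
  intro w hw
  refine ⟨le_of_lt hw, ?_⟩
  rintro rfl
  simp [upperHalf] at hw

lemma inv_mem_closedUpperHalf {v : ℂ} (h : v.im ≤ 0) (h0 : v ≠ 0) : v⁻¹ ∈ closedUpperHalf := by
  refine ⟨?_, inv_ne_zero h0⟩
  rw [inv_im]
  exact div_nonneg (by linarith) (normSq_nonneg _)

lemma inv_im_nonpos {w : ℂ} (h : 0 ≤ w.im) : w⁻¹.im ≤ 0 := by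
  rw [inv_im]
  exact div_nonpos_of_nonpos_of_nonneg (by linarith) (normSq_nonneg _)

/-- `G' = 1 - z G` does not vanish where `1 / G` lies in `ℂ⁺ ∪ ℝ`: a zero would be a fixed point of
`1 / G`, which is impossible since `1 / G` increases imaginary parts on `ℂ⁺` and is not real on
`ℝ`. -/
lemma one_sub_mul_gaussG_ne_zero {z : ℂ} (h : (gaussG z)⁻¹ ∈ closedUpperHalf) :
    1 - z * gaussG z ≠ 0 := by
  intro h1
  have h0 : gaussG z ≠ 0 := fun h0 => h.2 (by rw [h0, inv_zero])
  have hz : (gaussG z)⁻¹ = z := by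
    field_simp
    linear_combination h1
  have him := h.1
  rw [hz] at him
  rcases him.eq_or_lt with h2 | h2
  · have h3 := gaussG_im_neg him
    have h4 : z⁻¹.im < 0 := by rw [← hz, inv_inv]; exact h3
    rw [inv_im, ← h2] at h4
    simp at h4
  · have := inv_gaussG_im_lt h2
    rw [hz] at this
    exact lt_irrefl _ this

lemma deriv_gaussG (z : ℂ) : deriv gaussG z = 1 - z * gaussG z := (hasDerivAt_gaussG z).deriv

/-! ### Lifting segments through `G` -/

/-- The analytic local inverse of `G` at a noncritical point. -/
lemma exists_local_inverse {z : ℂ} (hz : 1 - z * gaussG z ≠ 0) :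
    ∃ s : ℂ → ℂ, AnalyticAt ℂ s (gaussG z) ∧ HasDerivAt s (1 - z * gaussG z)⁻¹ (gaussG z) ∧
      ∀ᶠ x in 𝓝 z, s (gaussG x) = x := by
  have ha : AnalyticAt ℂ gaussG z := analyticOnNhd_gaussG z trivial
  have hd : deriv gaussG z ≠ 0 := by rwa [deriv_gaussG]
  refine ⟨_, ha.analyticAt_localInverse hd, ?_,
    HasStrictDerivAt.eventually_left_inverse ha.hasStrictDerivAt hd⟩
  exact (ha.hasStrictDerivAt.to_localInverse hd).hasDerivAt.congr_deriv (by rw [deriv_gaussG])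

lemma gaussG_isLocalHomeomorphOn : IsLocalHomeomorphOn gaussG {z | 1 - z * gaussG z ≠ 0} := by
  intro z hz
  have ha : AnalyticAt ℂ gaussG z := analyticOnNhd_gaussG z trivial
  have hd : deriv gaussG z ≠ 0 := by rwa [deriv_gaussG]
  have h2 := ha.hasStrictDerivAt.hasStrictFDerivAt_equiv hd
  exact ⟨h2.toOpenPartialHomeomorph gaussG, h2.mem_toOpenPartialHomeomorph_source, rfl⟩

lemma isOpen_noncritical : IsOpen {z : ℂ | 1 - z * gaussG z ≠ 0} :=
  isOpen_ne_fun (by have := continuous_gaussG; fun_prop) continuous_const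

/-- A continuous local solution `g` of `G (g u) = γ u` is `s ∘ γ` for the local inverse `s`. -/
lemma lift_eventuallyEq {Y : Type*} {l : Filter Y} {g γ : Y → ℂ} {s : ℂ → ℂ} {z : ℂ}
    (hg : Tendsto g l (𝓝 z)) (hs : ∀ᶠ x in 𝓝 z, s (gaussG x) = x)
    (h : ∀ᶠ u in l, gaussG (g u) = γ u) : g =ᶠ[l] s ∘ γ := by
  filter_upwards [hg.eventually hs, h] with u h1 h2
  rw [Function.comp_apply, ← h2, h1]

lemma hasDerivWithinAt_lift {g γ : ℝ → ℂ} {γ' : ℂ} {S : Set ℝ} {t : ℝ}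
    (hg : ContinuousWithinAt g S t) (hγ : HasDerivWithinAt γ γ' S t) (htS : t ∈ S)
    (h : ∀ u ∈ S, gaussG (g u) = γ u) (hne : 1 - g t * γ t ≠ 0) :
    HasDerivWithinAt g (γ' / (1 - g t * γ t)) S t := by
  have ht := h t htS
  obtain ⟨s, -, hs, hinv⟩ := exists_local_inverse (z := g t) (by rwa [ht])
  have heq := lift_eventuallyEq hg hinv (eventually_nhdsWithin_of_forall h)
  rw [ht] at hs
  have := hs.comp_hasDerivWithinAt t hγ
  refine (this.congr_of_eventuallyEq heq ?_).congr_deriv (by rw [div_eq_inv_mul])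
  rw [Function.comp_apply, ← ht, hinv.self_of_nhds]

/-- Along a line segment that avoids `0`, the differential equation `g' = γ' / (1 - g γ)` for a lift
of `γ` through `G` keeps `g` bounded: `‖g'‖ ≤ ‖γ'‖` as soon as `‖g γ‖ ≥ 2`. -/
lemma norm_lift_le {g : ℝ → ℂ} {v d z₀ : ℂ} {m b : ℝ} (hm : 0 < m)
    (hγm : ∀ t ∈ Icc 0 b, m ≤ ‖v + t * d‖)
    (hγX : ∀ t ∈ Icc 0 b, (v + t * d)⁻¹ ∈ closedUpperHalf)
    (hg : ContinuousOn g (Icc 0 b)) (hg0 : g 0 = z₀)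
    (hG : ∀ t ∈ Icc 0 b, gaussG (g t) = v + t * d) :
    ∀ t ∈ Icc 0 b, ‖g t‖ ≤ ‖z₀‖ + 2 / m + (‖d‖ + 1) * t := by
  have hne : ∀ t ∈ Icc 0 b, 1 - g t * (v + t * d) ≠ 0 := by
    intro t ht
    rw [← hG t ht]
    exact one_sub_mul_gaussG_ne_zero (by rw [hG t ht]; exact hγX t ht)
  intro t ht
  have hlin : ∀ t : ℝ, HasDerivAt (fun t : ℝ => v + t * d) d t := by
    intro t
    simpa using ((ofRealCLM.hasDerivAt (x := t)).mul_const d).const_add v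
  refine image_norm_le_of_norm_deriv_right_lt_deriv_boundary hg
    (f' := fun t => d / (1 - g t * (v + t * d)))
    (B := fun t => ‖z₀‖ + 2 / m + (‖d‖ + 1) * t) (B' := fun _ => ‖d‖ + 1) ?_ ?_ ?_ ?_ ht
  · intro t ht
    have htI : t ∈ Icc 0 b := ⟨ht.1, ht.2.le⟩
    have := hasDerivWithinAt_lift (hg t htI) (hlin t).hasDerivWithinAt htI hG (hne t htI)
    exact this.mono_of_mem_nhdsWithin
      (mem_of_superset (Icc_mem_nhdsGE ht.2) (Icc_subset_Icc_left ht.1))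
  · rw [hg0]; simp; positivity
  · intro t
    simpa using ((hasDerivAt_id t).const_mul (‖d‖ + 1)).const_add (‖z₀‖ + 2 / m)
  · intro t ht hB
    have htI : t ∈ Icc 0 b := ⟨ht.1, ht.2.le⟩
    have h1 : 2 / m ≤ ‖g t‖ := by
      rw [hB]
      have : 0 ≤ (‖d‖ + 1) * t := mul_nonneg (by positivity) ht.1
      have := norm_nonneg z₀
      linarith
    have h2 : 2 ≤ ‖g t * (v + t * d)‖ := by
      rw [norm_mul]
      have h3 := mul_le_mul h1 (hγm t htI) hm.le (norm_nonneg _)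
      rwa [div_mul_cancel₀ _ hm.ne'] at h3
    have h3 : 1 ≤ ‖1 - g t * (v + t * d)‖ := by
      have := norm_sub_norm_le (g t * (v + t * d)) 1
      rw [norm_one, norm_sub_rev] at this
      linarith
    rw [norm_div]
    exact (div_le_self (norm_nonneg _) h3).trans_lt (by linarith)

/-- On a compact set of noncritical points, local sections of `G` exist on balls of a uniform
radius. -/
lemma exists_uniform_section {K : Set ℂ} (hK : IsCompact K)
    (hKW : K ⊆ {z | 1 - z * gaussG z ≠ 0}) :
    ∃ r > 0, ∀ z ∈ K, ∃ s : ℂ → ℂ, ContinuousOn s (Metric.ball (gaussG z) r) ∧ s (gaussG z) = z ∧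
      ∀ v ∈ Metric.ball (gaussG z) r, gaussG (s v) = v := by
  refine hK.induction_on (p := fun K => ∃ r > 0, ∀ z ∈ K, ∃ s : ℂ → ℂ,
    ContinuousOn s (Metric.ball (gaussG z) r) ∧ s (gaussG z) = z ∧
      ∀ v ∈ Metric.ball (gaussG z) r, gaussG (s v) = v) ?_ ?_ ?_ ?_
  · exact ⟨1, one_pos, by simp⟩
  · rintro S T hST ⟨r, hr, h⟩
    exact ⟨r, hr, fun z hz => h z (hST hz)⟩
  · rintro S T ⟨r, hr, h⟩ ⟨r', hr', h'⟩
    refine ⟨min r r', lt_min hr hr', ?_⟩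
    rintro z (hz | hz)
    · obtain ⟨s, h1, h2, h3⟩ := h z hz
      have := Metric.ball_subset_ball (x := gaussG z) (min_le_left r r')
      exact ⟨s, h1.mono this, h2, fun v hv => h3 v (this hv)⟩
    · obtain ⟨s, h1, h2, h3⟩ := h' z hz
      have := Metric.ball_subset_ball (x := gaussG z) (min_le_right r r')
      exact ⟨s, h1.mono this, h2, fun v hv => h3 v (this hv)⟩
  · intro z hz
    obtain ⟨e, hze, he⟩ := gaussG_isLocalHomeomorphOn z (hKW hz)
    have hmem : gaussG z ∈ e.target := by rw [he]; exact e.map_source hze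
    obtain ⟨ρ, hρ, hball⟩ := Metric.isOpen_iff.1 e.open_target _ hmem
    refine ⟨e.source ∩ gaussG ⁻¹' Metric.ball (gaussG z) (ρ / 2), ?_, ρ / 2, half_pos hρ, ?_⟩
    · refine mem_nhdsWithin_of_mem_nhds (inter_mem (e.open_source.mem_nhds hze) ?_)
      exact continuous_gaussG.continuousAt.preimage_mem_nhds (Metric.ball_mem_nhds _ (half_pos hρ))
    · rintro z' ⟨hz', hz''⟩
      have hsub : Metric.ball (gaussG z') (ρ / 2) ⊆ e.target := by
        refine Subset.trans (Metric.ball_subset_ball' ?_) hball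
        have := Metric.mem_ball.1 hz''
        linarith
      refine ⟨e.symm, e.continuousOn_symm.mono hsub, ?_, fun v hv => ?_⟩
      · rw [he]; exact e.left_inv hz'
      · rw [he]; exact e.right_inv (hsub hv)

/-- Every segment whose image under `v ↦ 1 / v` stays in `closedUpperHalf` lifts through `G`. -/
lemma exists_segment_lift {v d z₀ : ℂ} (hz₀ : gaussG z₀ = v)
    (hγX : ∀ t ∈ Icc (0 : ℝ) 1, (v + t * d)⁻¹ ∈ closedUpperHalf) :
    ∃ g : ℝ → ℂ, ContinuousOn g (Icc 0 1) ∧ g 0 = z₀ ∧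
      ∀ t ∈ Icc (0 : ℝ) 1, gaussG (g t) = v + t * d := by
  have hcont : Continuous fun t : ℝ => v + t * d := by fun_prop
  obtain ⟨t₀, ht₀, hmin⟩ := isCompact_Icc.exists_isMinOn (nonempty_Icc.2 zero_le_one)
    (hcont.norm.continuousOn (s := Icc (0 : ℝ) 1))
  set m := ‖v + t₀ * d‖ with hm_def
  -- a lift on any `[0, b] ⊆ [0, 1]` stays in the compact set `K`, on which local sections have a
  -- uniform radius `r`; so `N > ‖d‖ / r` equal steps suffice to lift the whole segment
  have hm : 0 < m := norm_pos_iff.2 fun h => (hγX t₀ ht₀).2 (by rw [h, inv_zero])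
  have hγm : ∀ t ∈ Icc (0 : ℝ) 1, m ≤ ‖v + t * d‖ := fun t ht => hmin ht
  set R := ‖z₀‖ + 2 / m + (‖d‖ + 1) * 1 with hR
  set K := Metric.closedBall (0 : ℂ) R ∩ gaussG ⁻¹' ((fun t : ℝ => v + t * d) '' Icc 0 1)
  have hK : IsCompact K := (isCompact_closedBall _ _).inter_right
    ((isCompact_Icc.image hcont).isClosed.preimage continuous_gaussG)
  have hKW : K ⊆ {z | 1 - z * gaussG z ≠ 0} := by
    rintro z ⟨-, t, ht, htz⟩
    exact one_sub_mul_gaussG_ne_zero (by rw [← htz]; exact hγX t ht)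
  obtain ⟨r, hr, hsec⟩ := exists_uniform_section hK hKW
  obtain ⟨N, hN⟩ := exists_nat_gt (‖d‖ / r)
  have hN0 : (0 : ℝ) < N := (div_nonneg (norm_nonneg _) hr.le).trans_lt hN
  have key : ∀ k : ℕ, k ≤ N → ∃ g : ℝ → ℂ, ContinuousOn g (Icc 0 (k / N)) ∧ g 0 = z₀ ∧
      ∀ t ∈ Icc (0 : ℝ) (k / N), gaussG (g t) = v + t * d := by
    intro k
    induction k with
    | zero =>
      intro _
      refine ⟨fun _ => z₀, continuousOn_const, rfl, ?_⟩
      intro t ht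
      have : t = 0 := by simpa using ht
      rw [this, hz₀]; simp
    | succ k ih =>
      intro hk
      obtain ⟨g, hg, hg0, hG⟩ := ih (Nat.le_of_succ_le hk)
      set a : ℝ := k / N with ha
      set b : ℝ := (k + 1 : ℕ) / N with hb
      have ha0 : 0 ≤ a := by positivity
      have hb1 : b ≤ 1 := (div_le_one hN0).2 (by exact_mod_cast hk)
      have hba : b - a = 1 / N := by rw [hb, ha]; push_cast; field_simp; ring
      have hab : a ≤ b := by
        have : 0 < 1 / (N : ℝ) := by positivity
        linarith
      have hsub : Icc 0 a ⊆ Icc (0 : ℝ) 1 := Icc_subset_Icc_right (hab.trans hb1)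
      have haI : a ∈ Icc 0 a := ⟨ha0, le_rfl⟩
      have hbd := norm_lift_le hm (fun t ht => hγm t (hsub ht)) (fun t ht => hγX t (hsub ht))
        hg hg0 hG a haI
      have hgK : g a ∈ K := by
        refine ⟨?_, a, hsub haI, (hG a haI).symm⟩
        rw [mem_closedBall_zero_iff]
        refine hbd.trans ?_
        rw [hR]
        have := mul_le_mul_of_nonneg_left (hab.trans hb1) (by positivity : 0 ≤ ‖d‖ + 1)
        linarith
      obtain ⟨s, hs, hsa, hGs⟩ := hsec _ hgK
      rw [hG a haI] at hs hsa hGs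
      have hmaps : ∀ t ∈ Icc a b, v + t * d ∈ Metric.ball (v + a * d) r := by
        intro t ht
        rw [mem_ball_iff_norm]
        have : v + t * d - (v + a * d) = ((t - a : ℝ) : ℂ) * d := by push_cast; ring
        rw [this, norm_mul, norm_real, Real.norm_of_nonneg (by linarith [ht.1])]
        have h1 : (t - a) * ‖d‖ ≤ 1 / N * ‖d‖ :=
          mul_le_mul_of_nonneg_right (by linarith [ht.2]) (norm_nonneg _)
        refine h1.trans_lt ?_
        rw [div_lt_iff₀ hr] at hN
        rw [one_div, inv_mul_lt_iff₀ hN0]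
        exact hN
      have heqR : EqOn (fun t : ℝ => if t ≤ a then g t else s (v + t * d))
          (fun t : ℝ => s (v + t * d)) (Icc a b) := by
        intro t ht
        rcases ht.1.eq_or_lt with h | h
        · simp [← h, hsa]
        · simp [not_le.2 h]
      have heqL : EqOn (fun t : ℝ => if t ≤ a then g t else s (v + t * d)) g (Icc 0 a) := by
        intro t ht
        simp [ht.2]
      refine ⟨fun t => if t ≤ a then g t else s (v + t * d), ?_, by simp [ha0, hg0], ?_⟩
      · rw [← Icc_union_Icc_eq_Icc ha0 hab]
        refine ContinuousOn.union_of_isClosed (hg.congr heqL) ?_ isClosed_Icc isClosed_Icc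
        exact (hs.comp hcont.continuousOn hmaps).congr heqR
      · intro t ht
        rcases le_total t a with h | h
        · rw [heqL ⟨ht.1, h⟩]; exact hG t ⟨ht.1, h⟩
        · rw [heqR ⟨h, ht.2⟩]; exact hGs _ (hmaps t ⟨h, ht.2⟩)
  have := key N le_rfl
  rwa [div_self hN0.ne'] at this

lemma inv_segment_mem_closedUpperHalf {v w : ℂ} (hv : v.im < 0) (hw : w ∈ closedUpperHalf) {t : ℝ}
    (ht : t ∈ Icc (0 : ℝ) 1) : (v + t * (w⁻¹ - v))⁻¹ ∈ closedUpperHalf := by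
  have hwi := inv_im_nonpos hw.1
  have him : (v + t * (w⁻¹ - v)).im = (1 - t) * v.im + t * w⁻¹.im := by
    simp only [add_im, mul_im, ofReal_re, ofReal_im, sub_im]; ring
  refine inv_mem_closedUpperHalf ?_ ?_
  · rw [him]
    nlinarith [ht.1, ht.2, mul_nonpos_of_nonneg_of_nonpos (sub_nonneg.2 ht.2) hv.le,
      mul_nonpos_of_nonneg_of_nonpos ht.1 hwi]
  · intro h0
    rcases ht.2.eq_or_lt with h | h
    · rw [h] at h0
      apply inv_ne_zero hw.2
      simpa using h0
    · have h1 := him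
      rw [h0, zero_im] at h1
      nlinarith [mul_neg_of_pos_of_neg (sub_pos.2 h) hv, mul_nonpos_of_nonneg_of_nonpos ht.1 hwi]

lemma isPreconnected_closedUpperHalf : IsPreconnected closedUpperHalf := by
  refine isPreconnected_upperHalf.subset_closure upperHalf_subset_closedUpperHalf ?_
  intro w hw
  have : closure upperHalf = {z : ℂ | 0 ≤ z.im} := closure_setOfPred_lt_im 0
  rw [this]
  exact hw.1

/-! ### The inverse of `F = 1 / G` -/

/-- `G` restricted to its noncritical points, a local homeomorphism. -/
def noncriticalG : {z : ℂ | 1 - z * gaussG z ≠ 0} → ℂ := fun z => gaussG z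

lemma isLocalHomeomorph_noncriticalG : IsLocalHomeomorph noncriticalG := by
  rw [isLocalHomeomorph_iff_isLocalHomeomorphOn_univ]
  exact gaussG_isLocalHomeomorphOn.comp
    (isOpen_noncritical.isOpenEmbedding_subtypeVal.isLocalHomeomorph.isLocalHomeomorphOn)
    fun z _ => z.2

/-- Two continuous right inverses of `1 / G` on a connected set agree if they agree at a point. -/
lemma eqOn_of_gaussG_eq {Y : Type*} [TopologicalSpace Y] {S : Set Y} (hS : IsPreconnected S)
    {g₁ g₂ : Y → ℂ} (h₁ : ContinuousOn g₁ S) (h₂ : ContinuousOn g₂ S)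
    (hX : ∀ a ∈ S, (gaussG (g₁ a))⁻¹ ∈ closedUpperHalf)
    (he : ∀ a ∈ S, gaussG (g₁ a) = gaussG (g₂ a)) {a : Y} (ha : a ∈ S) (hga : g₁ a = g₂ a) :
    EqOn g₁ g₂ S := by
  have : PreconnectedSpace S := isPreconnected_iff_preconnectedSpace.1 hS
  let G₁ : S → {z : ℂ | 1 - z * gaussG z ≠ 0} :=
    fun a => ⟨g₁ a, one_sub_mul_gaussG_ne_zero (hX a a.2)⟩
  let G₂ : S → {z : ℂ | 1 - z * gaussG z ≠ 0} :=
    fun a => ⟨g₂ a, one_sub_mul_gaussG_ne_zero (he a a.2 ▸ hX a a.2)⟩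
  have hG₁ : Continuous G₁ := (continuousOn_iff_continuous_domRestrict.1 h₁).subtype_mk _
  have hG₂ : Continuous G₂ := (continuousOn_iff_continuous_domRestrict.1 h₂).subtype_mk _
  have heq := (T2Space.isSeparatedMap noncriticalG).eq_of_comp_eq
    isLocalHomeomorph_noncriticalG.isLocallyInjective hG₁ hG₂ (funext fun a => he a a.2) ⟨a, ha⟩
    (Subtype.ext hga)
  intro b hb
  exact congrArg Subtype.val (congrFun heq ⟨b, hb⟩)

/-- The inverse of `F = 1 / G` on `ℂ⁺` extends to a continuous right inverse of `F` on the closed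
upper half-plane without `0`: segments in the variable `1 / w` that issue from `G(i)` lift through
`G`, and the lifts depend continuously on their end point. -/
theorem exists_inverse_function : ∃ f : ℂ → ℂ, ContinuousOn f closedUpperHalf ∧
    (∀ w ∈ closedUpperHalf, gaussG (f w) = w⁻¹) ∧ ∀ z ∈ upperHalf, f (gaussG z)⁻¹ = z := by
  have hv : (gaussG I).im < 0 := gaussG_im_neg (by simp)
  have hlift : ∀ a : closedUpperHalf, ∃ g : ℝ → ℂ, ContinuousOn g (Icc 0 1) ∧ g 0 = I ∧
      ∀ t ∈ Icc (0 : ℝ) 1, gaussG (g t) = gaussG I + t * ((a : ℂ)⁻¹ - gaussG I) := fun a =>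
    exists_segment_lift rfl fun t ht => inv_segment_mem_closedUpperHalf hv a.2 ht
  choose g hg hg0 hG using hlift
  let base : C(unitInterval × closedUpperHalf, ℂ) :=
    ⟨fun p => gaussG I + ((p.1 : ℝ) : ℂ) * ((p.2 : ℂ)⁻¹ - gaussG I), by
      have h1 : Continuous fun p : unitInterval × closedUpperHalf => (p.2 : ℂ)⁻¹ :=
        (continuous_subtype_val.comp continuous_snd).inv₀ fun p => p.2.2.2
      have h2 : Continuous fun p : unitInterval × closedUpperHalf => ((p.1 : ℝ) : ℂ) := by fun_prop
      fun_prop⟩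
  -- the lifts of the single segments form a lift of the whole family, which is continuous because
  -- it is so on the initial points and along each segment
  let lift : unitInterval × closedUpperHalf → {z : ℂ | 1 - z * gaussG z ≠ 0} := fun p =>
    ⟨g p.2 p.1, one_sub_mul_gaussG_ne_zero (by
      rw [hG p.2 p.1 p.1.2]; exact inv_segment_mem_closedUpperHalf hv p.2.2 p.1.2)⟩
  have hcont : Continuous lift := by
    refine isLocalHomeomorph_noncriticalG.continuous_lift (T2Space.isSeparatedMap _) base
      (funext fun p => hG p.2 p.1 p.1.2) ?_ ?_
    · have : (fun a => lift (0, a)) = fun _ => ⟨I, one_sub_mul_gaussG_ne_zero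
          (inv_mem_closedUpperHalf hv.le (gaussG_ne_zero (by simp)))⟩ := by
        ext a; exact hg0 a
      rw [this]
      exact continuous_const
    · intro a
      exact (continuousOn_iff_continuous_domRestrict.1 (hg a)).subtype_mk _
  have hone : (1 : ℝ) ∈ Icc (0 : ℝ) 1 := ⟨zero_le_one, le_rfl⟩
  classical
  let f : ℂ → ℂ := fun w => if h : w ∈ closedUpperHalf then g ⟨w, h⟩ 1 else 0
  have hf : ∀ w : closedUpperHalf, f w = g w 1 := fun w => dif_pos w.2
  have hfcont : ContinuousOn f closedUpperHalf := by
    rw [continuousOn_iff_continuous_domRestrict]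
    have : closedUpperHalf.domRestrict f = fun a => (lift (1, a) : ℂ) := by
      ext a; exact hf a
    rw [this]
    exact continuous_subtype_val.comp (hcont.comp (Continuous.prodMk_right 1))
  have hfG : ∀ w ∈ closedUpperHalf, gaussG (f w) = w⁻¹ := by
    intro w hw
    rw [hf ⟨w, hw⟩, hG _ 1 hone]
    push_cast; ring
  refine ⟨f, hfcont, hfG, ?_⟩
  -- at `w = 1 / G(i)` the segment is constant, and so is its lift
  have hX : ∀ z ∈ upperHalf, (gaussG z)⁻¹ ∈ closedUpperHalf := fun z hz =>
    inv_mem_closedUpperHalf (gaussG_im_neg (le_of_lt hz)).le (gaussG_ne_zero (le_of_lt hz))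
  have hI : I ∈ upperHalf := by simp [upperHalf]
  have hfI : f (gaussG I)⁻¹ = I := by
    rw [hf ⟨_, hX I hI⟩]
    have := eqOn_of_gaussG_eq isPreconnected_Icc (hg ⟨_, hX I hI⟩)
      (continuousOn_const (c := I)) (fun t ht => by
        rw [hG _ t ht]; exact inv_segment_mem_closedUpperHalf hv (hX I hI) ht)
      (fun t ht => by rw [hG _ t ht, inv_inv]; ring) (left_mem_Icc.2 zero_le_one) (hg0 _)
    exact this hone
  refine eqOn_of_gaussG_eq (g₁ := fun z => f (gaussG z)⁻¹) (g₂ := id) isPreconnected_upperHalf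
    (hfcont.comp ?_ hX) continuousOn_id (fun z hz => ?_) (fun z hz => ?_) hI hfI
  · exact continuous_gaussG.continuousOn.inv₀ fun z hz => gaussG_ne_zero (le_of_lt hz)
  · rw [hfG _ (hX z hz), inv_inv]; exact hX z hz
  · rw [hfG _ (hX z hz), inv_inv]; rfl

/-- The inverse `F⁻¹` of `F = 1 / G` on `closedUpperHalf`; its values elsewhere are irrelevant. -/
def gaussInv : ℂ → ℂ := exists_inverse_function.choose

lemma continuousOn_gaussInv : ContinuousOn gaussInv closedUpperHalf :=
  exists_inverse_function.choose_spec.1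

lemma gaussG_gaussInv {w : ℂ} (hw : w ∈ closedUpperHalf) : gaussG (gaussInv w) = w⁻¹ :=
  exists_inverse_function.choose_spec.2.1 w hw

lemma gaussInv_inv_gaussG {z : ℂ} (hz : z ∈ upperHalf) : gaussInv (gaussG z)⁻¹ = z :=
  exists_inverse_function.choose_spec.2.2 z hz

/-- The extension `F⁻¹(w) - w` to `closedUpperHalf` of the Voiculescu transform of `N(0,1)`. -/
def gaussVoiculescu (w : ℂ) : ℂ := gaussInv w - w

lemma continuousOn_gaussVoiculescu : ContinuousOn gaussVoiculescu closedUpperHalf :=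
  continuousOn_gaussInv.sub continuousOn_id

lemma gaussVoiculescu_ne_zero {w : ℂ} (hw : w ∈ closedUpperHalf) : gaussVoiculescu w ≠ 0 := by
  intro h
  have h1 : gaussInv w = w := sub_eq_zero.1 h
  have h2 := one_sub_mul_gaussG_ne_zero (z := gaussInv w)
    (by rw [gaussG_gaussInv hw, inv_inv]; exact hw)
  rw [gaussG_gaussInv hw, h1, mul_inv_cancel₀ hw.2, sub_self] at h2
  exact h2 rfl

/-- The inverse inherits the symmetry of `G`; the point `1 / G(i)` is fixed by the reflection. -/
lemma gaussInv_neg_conj {w : ℂ} (hw : w ∈ closedUpperHalf) :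
    gaussInv (-conj w) = -conj (gaussInv w) := by
  have hmaps : MapsTo (fun w : ℂ => -conj w) closedUpperHalf closedUpperHalf := by
    intro w hw
    exact ⟨by simpa using hw.1, by simpa using hw.2⟩
  have hI : I ∈ upperHalf := by simp [upperHalf]
  have hX : (gaussG I)⁻¹ ∈ closedUpperHalf :=
    inv_mem_closedUpperHalf (gaussG_im_neg (by simp)).le (gaussG_ne_zero (by simp))
  refine eqOn_of_gaussG_eq (g₁ := fun w => gaussInv (-conj w)) (g₂ := fun w => -conj (gaussInv w))
    isPreconnected_closedUpperHalf (continuousOn_gaussInv.comp (by fun_prop) hmaps)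
    (continuous_conj.comp_continuousOn continuousOn_gaussInv).neg
    (fun w hw => ?_) (fun w hw => ?_) hX ?_ hw
  · rw [gaussG_gaussInv (hmaps hw), inv_inv]; exact hmaps hw
  · rw [gaussG_gaussInv (hmaps hw), gaussG_neg_conj, gaussG_gaussInv hw]
    simp [inv_neg]
  · have h1 : -conj (gaussG I)⁻¹ = (gaussG I)⁻¹ := by
      have := gaussG_neg_conj I
      rw [conj_I, neg_neg] at this
      rw [map_inv₀, ← inv_neg, ← this]
    simp only [h1, gaussInv_inv_gaussG hI, conj_I, neg_neg]

/-! ### Analyticity and the differential equation of the inverse -/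

/-- Near each point of `closedUpperHalf`, including the real points, the inverse function is the
restriction of an analytic function. Its derivative is that of the differential equation
`f' = 1 / (w (f - w))`. -/
lemma exists_analyticAt_gaussInv {w : ℂ} (hw : w ∈ closedUpperHalf) :
    ∃ s : ℂ → ℂ, AnalyticAt ℂ s w ∧ HasDerivAt s (1 / (w * gaussVoiculescu w)) w ∧
      gaussInv =ᶠ[𝓝[closedUpperHalf] w] s := by
  have hG := gaussG_gaussInv hw
  have hne : 1 - gaussInv w * gaussG (gaussInv w) ≠ 0 :=
    one_sub_mul_gaussG_ne_zero (by rw [hG, inv_inv]; exact hw)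
  obtain ⟨s, hsa, hsd, hs⟩ := exists_local_inverse hne
  refine ⟨fun w => s w⁻¹, ?_, ?_, ?_⟩
  · exact AnalyticAt.comp (by rwa [hG] at hsa) (analyticAt_inv hw.2)
  · rw [hG] at hsd hne
    refine (hsd.comp w (hasDerivAt_inv hw.2)).congr_deriv ?_
    have h1 := gaussVoiculescu_ne_zero hw
    have h2 := hw.2
    have h3 : 1 - gaussInv w * w⁻¹ = -(gaussVoiculescu w) / w := by
      rw [gaussVoiculescu]; field_simp; ring
    rw [h3]
    field_simp
  · exact lift_eventuallyEq (γ := fun w => w⁻¹) (continuousOn_gaussInv w hw) hs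
      (eventually_nhdsWithin_of_forall fun u hu => gaussG_gaussInv hu)

lemma closedUpperHalf_mem_nhds {w : ℂ} (hw : w ∈ upperHalf) : closedUpperHalf ∈ 𝓝 w :=
  mem_of_superset (isOpen_upperHalf.mem_nhds hw) upperHalf_subset_closedUpperHalf

lemma analyticOnNhd_gaussInv : AnalyticOnNhd ℂ gaussInv upperHalf := by
  intro w hw
  obtain ⟨s, hsa, -, hs⟩ := exists_analyticAt_gaussInv (upperHalf_subset_closedUpperHalf hw)
  rw [nhdsWithin_eq_nhds.2 (closedUpperHalf_mem_nhds hw)] at hs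
  exact hsa.congr hs.symm

lemma analyticOnNhd_gaussVoiculescu : AnalyticOnNhd ℂ gaussVoiculescu upperHalf :=
  analyticOnNhd_gaussInv.sub analyticOnNhd_id

/-- `Im F⁻¹(w) ≤ Im w`, because `F` increases imaginary parts on `ℂ⁺`. -/
lemma gaussVoiculescu_im_nonpos {w : ℂ} (hw : w ∈ closedUpperHalf) :
    (gaussVoiculescu w).im ≤ 0 := by
  rw [gaussVoiculescu, sub_im, sub_nonpos]
  rcases le_or_gt (gaussInv w).im 0 with h | h
  · exact h.trans hw.1
  · have := inv_gaussG_im_lt h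
    rw [gaussG_gaussInv hw, inv_inv] at this
    exact this.le

lemma ofReal_mem_closedUpperHalf {x : ℝ} (hx : x ≠ 0) : (x : ℂ) ∈ closedUpperHalf :=
  ⟨by simp, by exact_mod_cast hx⟩

/-- The boundary curve `gaussInv (ℝ ∖ {0})` lies in the open lower half-plane. -/
lemma gaussInv_ofReal_im_neg {x : ℝ} (hx : x ≠ 0) : (gaussInv x).im < 0 := by
  by_contra! h
  have := gaussG_im_neg h
  rw [gaussG_gaussInv (ofReal_mem_closedUpperHalf hx), ← ofReal_inv, ofReal_im] at this
  exact lt_irrefl _ this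

/-! ### Bounds for the Voiculescu transform -/

/-- Far from the real axis `F⁻¹(w)` stays within distance `1` of `w`: the estimate
`‖F(z) - z‖ ≤ 1 / Im z` prevents `Im F⁻¹` from crossing the value `1` on `{Im w > 2}`. -/
lemma norm_gaussVoiculescu_le_one {w : ℂ} (hw : 2 < w.im) :
    1 < (gaussInv w).im ∧ ‖gaussVoiculescu w‖ ≤ 1 := by
  have hsub : {w : ℂ | 2 < w.im} ⊆ closedUpperHalf := fun w hw =>
    upperHalf_subset_closedUpperHalf (show 0 < w.im from lt_trans two_pos hw)
  have hest : ∀ w : ℂ, 2 < w.im → 1 ≤ (gaussInv w).im → ‖gaussVoiculescu w‖ ≤ 1 := by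
    intro w hw h
    have h1 := norm_inv_gaussG_sub_le (zero_lt_one.trans_le h)
    rw [gaussG_gaussInv (hsub hw), inv_inv, norm_sub_rev] at h1
    exact h1.trans ((div_le_one (by linarith)).2 h)
  have hne : ∀ w : ℂ, 2 < w.im → (gaussInv w).im ≠ 1 := by
    intro w hw h
    have h1 := (abs_im_le_norm _).trans (hest w hw h.ge)
    rw [gaussVoiculescu, sub_im, h, abs_le] at h1
    linarith
  have hgt : 1 < (gaussInv w).im := by
    by_contra! hle
    have hz : (I * 3) ∈ upperHalf := by simp [upperHalf]
    have hw' : 2 < ((gaussG (I * 3))⁻¹).im := by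
      have := inv_gaussG_im_lt hz
      have h3 : (I * 3 : ℂ).im = 3 := by simp
      linarith
    have hpre : IsPreconnected {w : ℂ | 2 < w.im} := (convex_halfSpace_im_gt 2).isPreconnected
    have hc : ContinuousOn (fun w => (gaussInv w).im) {w : ℂ | 2 < w.im} :=
      continuous_im.comp_continuousOn (continuousOn_gaussInv.mono hsub)
    have hmem : (1 : ℝ) ∈ Icc (gaussInv w).im (gaussInv (gaussG (I * 3))⁻¹).im := by
      rw [gaussInv_inv_gaussG hz]
      refine ⟨hle, ?_⟩
      simp
    obtain ⟨u, hu, hu1⟩ := hpre.intermediate_value hw hw' hc hmem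
    exact hne u hu hu1
  exact ⟨hgt, hest w hw hgt.le⟩

lemma hasDerivWithinAt_gaussVoiculescu_comp {γ : ℝ → ℂ} {γ' : ℂ} {S : Set ℝ} {t : ℝ}
    (hγ : HasDerivWithinAt γ γ' S t) (hS : MapsTo γ S closedUpperHalf) (ht : t ∈ S) :
    HasDerivWithinAt (fun t => gaussVoiculescu (γ t))
      ((1 / (γ t * gaussVoiculescu (γ t)) - 1) * γ') S t := by
  obtain ⟨s, -, hsd, hs⟩ := exists_analyticAt_gaussInv (hS ht)
  have h1 := ((hsd.sub (hasDerivAt_id _)).comp_hasDerivWithinAt t hγ)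
  refine h1.congr_of_eventuallyEq ?_ ?_
  · have := (hγ.continuousWithinAt.tendsto_nhdsWithin hS).eventually hs
    filter_upwards [this] with u hu
    simp only [gaussVoiculescu, hu, Function.comp_apply, Pi.sub_apply, id]
  · have := hs.self_of_nhdsWithin (hS ht)
    simp only [gaussVoiculescu, this, Function.comp_apply, Pi.sub_apply, id]

/-- A bound for the Voiculescu transform near the real axis, obtained by integrating the
differential equation `φ' = 1 / (w φ) - 1` down from the line `Im w = 3`. -/
lemma norm_gaussVoiculescu_le_log {w : ℂ} (hw : w ∈ closedUpperHalf) (hw3 : w.im ≤ 3) :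
    ‖gaussVoiculescu w‖ ≤ 7 + 2 * Real.log ((|w.re| + 3) / (|w.re| + w.im)) := by
  set x := w.re
  set y := w.im
  have hy0 : 0 ≤ y := hw.1
  have hpos : 0 < |x| + y := by
    rcases hy0.eq_or_lt with h | h
    · have : x ≠ 0 := fun hx => hw.2 (Complex.ext hx h.symm)
      have := abs_pos.2 this
      linarith
    · have := abs_nonneg x
      linarith
  set γ : ℝ → ℂ := fun t => x + (3 - t : ℝ) * I with hγ
  have hre : ∀ t, (γ t).re = x := by intro t; simp [hγ]
  have him : ∀ t, (γ t).im = 3 - t := by intro t; simp [hγ]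
  have hmaps : MapsTo γ (Icc 0 (3 - y)) closedUpperHalf := by
    intro t ht
    refine ⟨by rw [him]; linarith [ht.2], fun h0 => ?_⟩
    have h1 := congrArg Complex.re h0
    have h2 := congrArg Complex.im h0
    rw [hre, zero_re] at h1
    rw [him, zero_im] at h2
    rw [h1, abs_zero] at hpos
    linarith [ht.2]
  have hγd : ∀ t, HasDerivAt γ (-I) t := by
    intro t
    have h1 : HasDerivAt (fun t : ℝ => ((3 - t : ℝ) : ℂ)) (-1) t := by
      simpa using ((hasDerivAt_id t).const_sub 3).ofReal_comp
    exact ((h1.mul_const I).const_add (x : ℂ)).congr_deriv (by ring)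
  have hγc : Continuous γ := by fun_prop
  have hspos : ∀ t ∈ Icc 0 (3 - y), 0 < |x| + 3 - t := fun t ht => by linarith [ht.2]
  have hBd : ∀ t ∈ Icc 0 (3 - y), HasDerivAt
      (fun t => 1 + 2 * t + 2 * Real.log (|x| + 3) - 2 * Real.log (|x| + 3 - t))
      (2 + 2 / (|x| + 3 - t)) t := by
    intro t ht
    have h1 := (((hasDerivAt_id t).const_sub (|x| + 3)).log (hspos t ht).ne').const_mul 2
    have h2 := (((hasDerivAt_id t).const_mul 2).const_add 1).add_const (2 * Real.log (|x| + 3))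
    refine (h2.sub h1).congr_deriv ?_
    simp only [id]
    ring
  -- the majorant starts at `1` at height `3`; where `‖φ‖` meets it, `‖φ‖ ≥ 1`, and the speed of `φ`
  -- is at most `1 / ‖γ t‖ + 1`, which is less than the slope `2 + 2 / (|x| + 3 - t)`
  have hmain := image_norm_le_of_norm_deriv_right_lt_deriv_boundary'
    (f := fun t => gaussVoiculescu (γ t)) (a := 0) (b := 3 - y)
    (f' := fun t => (1 / (γ t * gaussVoiculescu (γ t)) - 1) * (-I))
    (B := fun t => 1 + 2 * t + 2 * Real.log (|x| + 3) - 2 * Real.log (|x| + 3 - t))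
    (B' := fun t => 2 + 2 / (|x| + 3 - t))
    (continuousOn_gaussVoiculescu.comp hγc.continuousOn hmaps) ?_ ?_
    (fun t ht => (hBd t ht).continuousAt.continuousWithinAt)
    (fun t ht => (hBd t ⟨ht.1, ht.2.le⟩).hasDerivWithinAt) ?_
    (x := 3 - y) ⟨by linarith, le_rfl⟩
  · have hγw : γ (3 - y) = w := Complex.ext (hre _) (by rw [him]; ring)
    rw [hγw] at hmain
    refine hmain.trans ?_
    have h1 : |x| + 3 - (3 - y) = |x| + y := by ring
    rw [h1, Real.log_div (by positivity) hpos.ne']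
    linarith
  · intro t ht
    have htI : t ∈ Icc 0 (3 - y) := ⟨ht.1, ht.2.le⟩
    exact (hasDerivWithinAt_gaussVoiculescu_comp (hγd t).hasDerivWithinAt hmaps htI
      ).mono_of_mem_nhdsWithin
      (mem_of_superset (Icc_mem_nhdsGE ht.2) (Icc_subset_Icc_left ht.1))
  · have := (norm_gaussVoiculescu_le_one (w := γ 0) (by rw [him]; norm_num)).2
    simpa using this
  · intro t ht hB
    have htI : t ∈ Icc 0 (3 - y) := ⟨ht.1, ht.2.le⟩
    have hs := hspos t htI
    have hB1 : 1 ≤ ‖gaussVoiculescu (γ t)‖ := by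
      rw [hB]
      have := Real.log_le_log hs (by linarith [ht.1] : |x| + 3 - t ≤ |x| + 3)
      linarith [ht.1]
    have hγn : (|x| + 3 - t) / 2 ≤ ‖γ t‖ := by
      have h1 := abs_re_le_norm (γ t)
      have h2 := abs_im_le_norm (γ t)
      rw [hre] at h1
      rw [him] at h2
      have := le_abs_self (3 - t)
      linarith
    have hγpos : 0 < ‖γ t‖ := lt_of_lt_of_le (by linarith) hγn
    rw [norm_mul, norm_neg, norm_I, mul_one]
    refine (norm_sub_le _ _).trans_lt ?_
    rw [norm_div, norm_one, norm_mul]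
    have h1 : 1 / (‖γ t‖ * ‖gaussVoiculescu (γ t)‖) ≤ 2 / (|x| + 3 - t) := by
      rw [div_le_div_iff₀ (by positivity) hs]
      nlinarith
    linarith

lemma norm_gaussVoiculescu_le_of_re_ne_zero {w : ℂ} (hw : 0 ≤ w.im) (hx : w.re ≠ 0) :
    ‖gaussVoiculescu w‖ ≤ 7 + 2 * Real.log (1 + 3 / |w.re|) := by
  have habs := abs_pos.2 hx
  have hlog : 0 ≤ Real.log (1 + 3 / |w.re|) := Real.log_nonneg (by
    have : 0 ≤ 3 / |w.re| := by positivity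
    linarith)
  rcases le_or_gt w.im 3 with h | h
  · refine (norm_gaussVoiculescu_le_log ⟨hw, fun h0 => hx (by rw [h0, zero_re])⟩ h).trans ?_
    have : Real.log ((|w.re| + 3) / (|w.re| + w.im)) ≤ Real.log (1 + 3 / |w.re|) := by
      apply Real.log_le_log (by positivity)
      rw [div_le_iff₀ (by positivity)]
      have : (1 + 3 / |w.re|) * |w.re| = |w.re| + 3 := by field_simp
      have : 0 ≤ (1 + 3 / |w.re|) * w.im := by positivity
      linarith
    linarith
  · have := (norm_gaussVoiculescu_le_one (by linarith : 2 < w.im)).2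
    linarith

lemma norm_gaussVoiculescu_le_of_le_im {w : ℂ} {ε : ℝ} (hε : 0 < ε) (hw : ε ≤ w.im) :
    ‖gaussVoiculescu w‖ ≤ 7 + 2 * Real.log (1 + 3 / ε) := by
  have hlog : 0 ≤ Real.log (1 + 3 / ε) := Real.log_nonneg (by
    have : 0 ≤ 3 / ε := by positivity
    linarith)
  rcases le_or_gt w.im 3 with h | h
  · have hX := upperHalf_subset_closedUpperHalf (hε.trans_le hw : 0 < w.im)
    refine (norm_gaussVoiculescu_le_log hX h).trans ?_
    have : Real.log ((|w.re| + 3) / (|w.re| + w.im)) ≤ Real.log (1 + 3 / ε) := by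
      apply Real.log_le_log (by have := hX.1; have := hε.trans_le hw; positivity)
      have := hε.trans_le hw
      rw [div_le_iff₀ (by positivity)]
      have h1 : (1 + 3 / ε) * ε = ε + 3 := by field_simp
      have h2 : 0 ≤ 3 / ε := by positivity
      have h3 : (1 + 3 / ε) * ε ≤ (1 + 3 / ε) * w.im := mul_le_mul_of_nonneg_left hw (by linarith)
      have h4 : 0 ≤ 3 / ε * |w.re| := by positivity
      nlinarith
    linarith
  · have := (norm_gaussVoiculescu_le_one (by linarith : 2 < w.im)).2
    linarith

/-! ### The function `h` -/

/-- The function `h(x) = -Im F⁻¹(x)` on `ℝ ∖ {0}`; its value at `0` is irrelevant. -/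
def levyH (x : ℝ) : ℝ := -(gaussInv x).im

lemma levyH_pos {x : ℝ} (hx : x ≠ 0) : 0 < levyH x := neg_pos.2 (gaussInv_ofReal_im_neg hx)

lemma levyH_neg (x : ℝ) : levyH (-x) = levyH x := by
  rcases eq_or_ne x 0 with rfl | hx
  · simp
  · have := gaussInv_neg_conj (ofReal_mem_closedUpperHalf hx)
    rw [conj_ofReal] at this
    rw [levyH, levyH, ofReal_neg, this]
    simp

lemma levyH_abs (x : ℝ) : levyH |x| = levyH x := by
  rcases abs_choice x with h | h <;> rw [h]
  exact levyH_neg x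

lemma levyH_eq (x : ℝ) : levyH x = -(gaussVoiculescu x).im := by
  simp [levyH, gaussVoiculescu]

/-- Near a real point `x ≠ 0`, `h` is the restriction of `-Im s` for an analytic function `s`. -/
lemma levyH_local {x : ℝ} (hx : x ≠ 0) : ∃ s : ℂ → ℂ, AnalyticAt ℂ s x ∧
    HasDerivAt s (1 / (x * gaussVoiculescu x)) x ∧ levyH =ᶠ[𝓝 x] fun t : ℝ => -(s t).im := by
  have hX := ofReal_mem_closedUpperHalf hx
  obtain ⟨s, hsa, hsd, hs⟩ := exists_analyticAt_gaussInv hX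
  refine ⟨s, hsa, hsd, ?_⟩
  have hmem : {t : ℝ | t ≠ 0} ∈ 𝓝 x := isOpen_ne.mem_nhds hx
  have htend : Tendsto (fun t : ℝ => (t : ℂ)) (𝓝 x) (𝓝[closedUpperHalf] (x : ℂ)) :=
    tendsto_nhdsWithin_iff.2 ⟨continuous_ofReal.continuousAt,
      mem_of_superset hmem fun t ht => ofReal_mem_closedUpperHalf ht⟩
  filter_upwards [htend.eventually hs] with t ht
  rw [levyH, ht]

lemma analyticAt_levyH {x : ℝ} (hx : x ≠ 0) : AnalyticAt ℝ levyH x := by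
  obtain ⟨s, hsa, -, hs⟩ := levyH_local hx
  have h1 : AnalyticAt ℝ (fun t : ℝ => (t : ℂ)) x := ofRealCLM.analyticAt x
  have h2 : AnalyticAt ℝ (fun t : ℝ => s t) x := (hsa.restrictScalars (𝕜 := ℝ)).fun_comp h1
  have h3 : AnalyticAt ℝ (fun t : ℝ => (s t).im) x := (imCLM.analyticAt _).fun_comp h2
  exact h3.neg.congr hs.symm

/-- On the real axis the differential equation `φ' = 1 / (x φ) - 1` gives
`h' = -h / (x |φ|²)`. -/
lemma hasDerivAt_levyH {x : ℝ} (hx : x ≠ 0) :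
    HasDerivAt levyH (-(levyH x / (x * ‖gaussVoiculescu x‖ ^ 2))) x := by
  obtain ⟨s, -, hsd, hs⟩ := levyH_local hx
  have h1 : HasDerivAt (fun t : ℝ => s t) (1 / (x * gaussVoiculescu x)) x := hsd.comp_ofReal
  have h2 := (imCLM.hasFDerivAt.comp_hasDerivAt x h1).neg
  refine (h2.congr_of_eventuallyEq hs).congr_deriv ?_
  have h4 : (1 / ((x : ℂ) * gaussVoiculescu x)) = ((x⁻¹ : ℝ) : ℂ) * (gaussVoiculescu x)⁻¹ := by
    push_cast; rw [one_div, mul_inv]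
  rw [imCLM_apply, h4, im_ofReal_mul, inv_im, normSq_eq_norm_sq, levyH_eq]
  have h5 : ‖gaussVoiculescu x‖ ≠ 0 := norm_ne_zero_iff.2
    (gaussVoiculescu_ne_zero (ofReal_mem_closedUpperHalf hx))
  field_simp

lemma deriv_levyH_neg {x : ℝ} (hx : 0 < x) : deriv levyH x < 0 := by
  rw [(hasDerivAt_levyH hx.ne').deriv, neg_lt_zero]
  have := levyH_pos hx.ne'
  have : 0 < ‖gaussVoiculescu x‖ := norm_pos_iff.2
    (gaussVoiculescu_ne_zero (ofReal_mem_closedUpperHalf hx.ne'))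
  positivity

/-! ### The domain on which `F` is univalent -/

/-- The domain `Ω = F⁻¹(ℂ⁺)`, for the branch `gaussInv` of the inverse. -/
def gaussDomain : Set ℂ := gaussInv '' upperHalf

lemma isOpen_gaussDomain : IsOpen gaussDomain := by
  rw [isOpen_iff_mem_nhds]
  rintro _ ⟨w, hw, rfl⟩
  have hX := upperHalf_subset_closedUpperHalf hw
  obtain ⟨s, hsa, hsd, hs⟩ := exists_analyticAt_gaussInv hX
  rw [nhdsWithin_eq_nhds.2 (closedUpperHalf_mem_nhds hw)] at hs
  have hd := (hsd.congr_of_eventuallyEq hs)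
  have hst := (analyticOnNhd_gaussInv w hw).hasStrictDerivAt
  rw [hd.deriv] at hst
  rw [← hst.map_nhds_eq (one_div_ne_zero (mul_ne_zero hX.2 (gaussVoiculescu_ne_zero hX)))]
  exact image_mem_map (isOpen_upperHalf.mem_nhds hw)

lemma gaussF_gaussInv {w : ℂ} (hw : w ∈ closedUpperHalf) : gaussF (gaussInv w) = w := by
  rw [gaussF, gaussG_gaussInv hw, one_div, inv_inv]

lemma gaussInv_gaussF {z : ℂ} (hz : z ∈ upperHalf) : gaussInv (gaussF z) = z := by
  rw [gaussF, one_div, gaussInv_inv_gaussG hz]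

lemma gaussF_mem_upperHalf {z : ℂ} (hz : z ∈ upperHalf) : gaussF z ∈ upperHalf := by
  rw [gaussF, one_div]
  exact lt_trans hz (inv_gaussG_im_lt hz)

lemma gaussF_eqOn_recipCauchy : EqOn gaussF (recipCauchy (gaussianReal 0 1)) upperHalf := by
  intro z hz
  rw [gaussF, recipCauchy, gaussG_eqOn_cauchyTransform hz]

lemma isUnivalentExtension_gaussF :
    IsUnivalentExtension (gaussianReal 0 1) gaussDomain gaussF := by
  refine ⟨isOpen_gaussDomain, ?_, ?_, gaussF_eqOn_recipCauchy, ?_, ?_⟩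
  · have : IsConnected upperHalf := ⟨⟨I, by simp [upperHalf]⟩, isPreconnected_upperHalf⟩
    exact this.image _ (continuousOn_gaussInv.mono upperHalf_subset_closedUpperHalf)
  · intro z hz
    exact ⟨gaussF z, gaussF_mem_upperHalf hz, gaussInv_gaussF hz⟩
  · rintro _ ⟨w, hw, rfl⟩
    have hX := upperHalf_subset_closedUpperHalf hw
    refine AnalyticAt.div analyticAt_const (analyticOnNhd_gaussG _ trivial) ?_
    rw [gaussG_gaussInv hX]
    exact inv_ne_zero hX.2
  · refine ⟨?_, ?_, ?_⟩
    · rintro _ ⟨w, hw, rfl⟩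
      rw [gaussF_gaussInv (upperHalf_subset_closedUpperHalf hw)]
      exact hw
    · rintro _ ⟨w, hw, rfl⟩ _ ⟨w', hw', rfl⟩ h
      rw [gaussF_gaussInv (upperHalf_subset_closedUpperHalf hw),
        gaussF_gaussInv (upperHalf_subset_closedUpperHalf hw')] at h
      rw [h]
    · intro w hw
      exact ⟨_, ⟨w, hw, rfl⟩, gaussF_gaussInv (upperHalf_subset_closedUpperHalf hw)⟩

/-- `gaussInv x` is the only boundary point of the domain that `F` maps to `x ≠ 0`. -/
lemma frontier_gaussDomain_iff {x : ℝ} (hx : x ≠ 0) (z : ℂ) :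
    (z ∈ frontier gaussDomain ∧ gaussF z = x) ↔ z = gaussInv x := by
  have hX := ofReal_mem_closedUpperHalf hx
  have hxc : (x : ℂ) ≠ 0 := hX.2
  constructor
  · rintro ⟨hz, hFz⟩
    have hG : gaussG z ≠ 0 := by
      intro h
      rw [gaussF, h, div_zero] at hFz
      exact hxc hFz.symm
    have hcont : ContinuousAt gaussF z :=
      continuousAt_const.div continuous_gaussG.continuousAt hG
    -- `F⁻¹ ∘ F` is the identity on the domain, and both are continuous up to `z`
    have hbot : (𝓝[gaussDomain] z).NeBot :=
      mem_closure_iff_nhdsWithin_neBot.1 (frontier_subset_closure hz)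
    have h1 : Tendsto gaussF (𝓝[gaussDomain] z) (𝓝[closedUpperHalf] (x : ℂ)) := by
      rw [tendsto_nhdsWithin_iff, ← hFz]
      refine ⟨hcont.tendsto.mono_left nhdsWithin_le_nhds, ?_⟩
      refine eventually_nhdsWithin_of_forall ?_
      rintro _ ⟨w, hw, rfl⟩
      rw [gaussF_gaussInv (upperHalf_subset_closedUpperHalf hw)]
      exact upperHalf_subset_closedUpperHalf hw
    have h2 := (continuousOn_gaussInv _ hX).tendsto.comp h1
    refine tendsto_nhds_unique ((tendsto_id.mono_left nhdsWithin_le_nhds).congr' ?_) h2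
    refine eventually_nhdsWithin_of_forall ?_
    rintro _ ⟨w, hw, rfl⟩
    rw [Function.comp_apply, gaussF_gaussInv (upperHalf_subset_closedUpperHalf hw), id]
  · rintro rfl
    refine ⟨?_, gaussF_gaussInv hX⟩
    rw [isOpen_gaussDomain.frontier_eq]
    refine ⟨?_, ?_⟩
    · have h1 : (x : ℂ) ∈ closure upperHalf := by
        have : closure upperHalf = {z : ℂ | 0 ≤ z.im} := closure_setOfPred_lt_im 0
        rw [this]
        exact hX.1
      exact ((continuousOn_gaussInv _ hX).mono upperHalf_subset_closedUpperHalf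
        ).mem_closure_image h1
    · rintro ⟨w, hw, h⟩
      have := congrArg gaussF h
      rw [gaussF_gaussInv hX, gaussF_gaussInv (upperHalf_subset_closedUpperHalf hw)] at this
      rw [this] at hw
      simp [upperHalf] at hw

/-! ### The Poisson formula for the upper half-plane -/

/-- The Poisson kernel `Im w / (π |w - x|²)` of the upper half-plane. -/
def halfPlanePoisson (w : ℂ) (x : ℝ) : ℝ := w.im / Real.pi * ‖1 / (w - x)‖ ^ 2

lemma norm_sq_cauchyKernel (w : ℂ) (x : ℝ) :
    ‖1 / (w - x)‖ ^ 2 = 1 / ((x - w.re) ^ 2 + w.im ^ 2) := by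
  rw [norm_div, norm_one, div_pow, one_pow, ← normSq_eq_norm_sq, normSq_apply]
  simp only [sub_re, ofReal_re, sub_im, ofReal_im, sub_zero]
  ring_nf

lemma halfPlanePoisson_eq_cauchyPDFReal {w : ℂ} (hw : 0 < w.im) (x : ℝ) :
    halfPlanePoisson w x = cauchyPDFReal w.re w.im.toNNReal x := by
  rw [halfPlanePoisson, norm_sq_cauchyKernel, cauchyPDFReal_def, Real.coe_toNNReal _ hw.le]
  rw [one_div]
  ring

lemma halfPlanePoisson_nonneg {w : ℂ} (hw : 0 < w.im) (x : ℝ) : 0 ≤ halfPlanePoisson w x := by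
  have := Real.pi_pos
  rw [halfPlanePoisson]; positivity

lemma integrable_halfPlanePoisson {w : ℂ} (hw : 0 < w.im) : Integrable (halfPlanePoisson w) :=
  (integrable_cauchyPDFReal w.re (γ := w.im.toNNReal)).congr
    (ae_of_all _ fun x => (halfPlanePoisson_eq_cauchyPDFReal hw x).symm)

lemma integral_halfPlanePoisson {w : ℂ} (hw : 0 < w.im) : ∫ x, halfPlanePoisson w x = 1 := by
  simp_rw [halfPlanePoisson_eq_cauchyPDFReal hw]
  exact integral_cauchyPDFReal_eq_one _ (Real.toNNReal_pos.2 hw).ne'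

lemma integral_ofReal_halfPlanePoisson {w : ℂ} (hw : 0 < w.im) :
    ∫ x : ℝ, (halfPlanePoisson w x : ℂ) = 1 :=
  (integral_ofReal (𝕜 := ℂ) (f := halfPlanePoisson w)).trans
    (by rw [integral_halfPlanePoisson hw]; simp)

lemma continuous_halfPlanePoisson {w : ℂ} (hw : 0 < w.im) : Continuous (halfPlanePoisson w) := by
  have hne := sub_ofReal_ne_zero hw.ne'
  unfold halfPlanePoisson
  exact continuous_const.mul ((continuous_const.div (by fun_prop) hne).norm.pow 2)

lemma halfPlanePoisson_le {w : ℂ} (hw : 0 < w.im) (x : ℝ) :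
    halfPlanePoisson w x ≤ 1 / (Real.pi * w.im) := by
  have := Real.pi_pos
  have h1 := pow_le_pow_left₀ (norm_nonneg _) (norm_cauchyKernel_le hw x) 2
  calc halfPlanePoisson w x ≤ w.im / Real.pi * (1 / w.im) ^ 2 := by
        rw [halfPlanePoisson]; gcongr
    _ = 1 / (Real.pi * w.im) := by field_simp

/-- Cauchy's theorem for the closed upper half-plane, for functions of quadratic decay. -/
lemma integral_real_eq_zero_of_decay {k : ℂ → ℂ} {K R₀ : ℝ}
    (hk : DifferentiableOn ℂ k {ζ | 0 ≤ ζ.im}) (hint : Integrable fun x : ℝ => k x)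
    (hdecay : ∀ ζ : ℂ, 0 ≤ ζ.im → R₀ ≤ ‖ζ‖ → ‖k ζ‖ ≤ K / ‖ζ‖ ^ 2) : ∫ x : ℝ, k x = 0 := by
  have hlim := intervalIntegral_tendsto_integral hint tendsto_neg_atTop_atBot tendsto_id
  have hzero : Tendsto (fun R : ℝ => ∫ x in (-R)..(id R), k x) atTop (𝓝 0) := by
    rw [tendsto_zero_iff_norm_tendsto_zero]
    refine squeeze_zero' (Eventually.of_forall fun _ => norm_nonneg _)
      (g := fun R : ℝ => 4 * |K| / R) ?_ (tendsto_const_nhds.div_atTop tendsto_id)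
    filter_upwards [eventually_ge_atTop R₀, eventually_gt_atTop 0] with R hR hR0
    have hb : ∀ ζ : ℂ, 0 ≤ ζ.im → R ≤ ‖ζ‖ → ‖k ζ‖ ≤ |K| / R ^ 2 := by
      intro ζ h1 h2
      refine (hdecay ζ h1 (hR.trans h2)).trans ?_
      exact div_le_div₀ (abs_nonneg _) (le_abs_self _) (by positivity)
        (pow_le_pow_left₀ hR0.le h2 2)
    -- the contour is the rectangle `[-R, R] × [0, R]`
    have hrect := integral_boundary_rect_eq_zero_of_differentiableOn k (-R : ℂ) (R + R * I)
      (hk.mono (by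
        intro ζ hζ
        have := hζ.2
        simp only [mem_preimage, neg_im, ofReal_im, neg_zero, add_im, mul_im, ofReal_re, I_im,
          mul_one, I_re, mul_zero, add_zero, zero_add] at this
        rw [uIcc_of_le hR0.le] at this
        exact this.1))
    simp only [neg_re, ofReal_re, add_re, mul_re, I_re, mul_zero, ofReal_im, I_im, mul_one,
      sub_self, add_zero, neg_im, neg_zero, ofReal_zero, zero_mul, add_im, mul_im, zero_add,
      ofReal_neg, smul_eq_mul] at hrect
    have htop : ‖∫ x : ℝ in (-R)..R, k (x + R * I)‖ ≤ |K| / R ^ 2 * |R - -R| := by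
      refine intervalIntegral.norm_integral_le_of_norm_le_const
        fun x _ => hb _ (by simp [hR0.le]) ?_
      have := abs_im_le_norm ((x : ℂ) + R * I)
      simp only [add_im, ofReal_im, mul_im, ofReal_re, I_im, mul_one, I_re, mul_zero, add_zero,
        zero_add] at this
      exact (le_abs_self R).trans this
    have hside : ∀ c : ℝ, |c| = R →
        ‖∫ y : ℝ in (0 : ℝ)..R, k (c + y * I)‖ ≤ |K| / R ^ 2 * |R - 0| := by
      intro c hc
      refine intervalIntegral.norm_integral_le_of_norm_le_const fun y hy => hb _ ?_ ?_
      · rw [uIoc_of_le hR0.le] at hy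
        simp [hy.1.le]
      · have := abs_re_le_norm ((c : ℂ) + y * I)
        simp only [add_re, ofReal_re, mul_re, I_re, mul_zero, ofReal_im, I_im, mul_one, sub_self,
          add_zero] at this
        rw [← hc]; exact this
    have h1 := hside R (abs_of_pos hR0)
    have h2 := hside (-R) (by rw [abs_neg, abs_of_pos hR0])
    have heq : ∫ x : ℝ in (-R)..R, k x = (∫ x : ℝ in (-R)..R, k (x + R * I)) -
        I * (∫ y : ℝ in (0 : ℝ)..R, k (R + y * I)) +
        I * ∫ y : ℝ in (0 : ℝ)..R, k ((-R : ℝ) + y * I) := by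
      push_cast
      linear_combination hrect
    rw [id, heq]
    refine (norm_add_le _ _).trans ?_
    have h3 := norm_sub_le (∫ x : ℝ in (-R)..R, k (x + R * I))
      (I * (∫ y : ℝ in (0 : ℝ)..R, k (R + y * I)))
    rw [norm_mul, norm_I, one_mul] at h3 ⊢
    have h4 : |K| / R ^ 2 * |R - -R| = 2 * |K| / R := by
      rw [abs_of_pos (a := R - -R) (by linarith)]; field_simp; ring
    have h5 : |K| / R ^ 2 * |R - 0| = |K| / R := by
      rw [abs_of_pos (a := R - 0) (by linarith)]; field_simp; ring
    rw [h4] at htop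
    rw [h5] at h1 h2
    have h6 : 4 * |K| / R = 2 * |K| / R + |K| / R + |K| / R := by ring
    linarith
  exact tendsto_nhds_unique hlim hzero

/-- The Poisson integral formula for a bounded analytic function on the closed upper half-plane:
Cauchy's theorem for `(ψ(ζ) - ψ(w)) / ((ζ - w)(ζ - w̄))`. -/
lemma poisson_formula {ψ : ℂ → ℂ} {C : ℝ} (hψ : DifferentiableOn ℂ ψ {ζ | 0 ≤ ζ.im})
    (hC : ∀ ζ : ℂ, 0 ≤ ζ.im → ‖ψ ζ‖ ≤ C) {w : ℂ} (hw : 0 < w.im) :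
    ∫ x : ℝ, (halfPlanePoisson w x : ℂ) * ψ x = ψ w := by
  have hnhds : {ζ : ℂ | 0 ≤ ζ.im} ∈ 𝓝 w :=
    mem_of_superset ((isOpen_lt continuous_const continuous_im).mem_nhds hw)
      fun ζ (hζ : 0 < ζ.im) => hζ.le
  have hconj : ∀ ζ : ℂ, 0 ≤ ζ.im → ζ - conj w ≠ 0 := by
    intro ζ hζ h
    have := congrArg Complex.im h
    simp at this
    linarith
  have hψc : Continuous fun x : ℝ => ψ x :=
    hψ.continuousOn.comp_continuous continuous_ofReal fun x => by simp
  have hP : Integrable fun x : ℝ => (halfPlanePoisson w x : ℂ) :=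
    (integrable_halfPlanePoisson hw).ofReal
  have hPψ : Integrable fun x : ℝ => (halfPlanePoisson w x : ℂ) * ψ x :=
    hP.mul_bdd hψc.aestronglyMeasurable (ae_of_all _ fun x => hC x (by simp))
  -- on the real line the quotient is a multiple of the Poisson kernel
  have hkreal : ∀ x : ℝ, dslope ψ w x / (x - conj w) =
      (Real.pi / w.im : ℝ) * ((halfPlanePoisson w x : ℂ) * ψ x - ψ w * halfPlanePoisson w x) := by
    intro x
    have hne : (x : ℂ) ≠ w := fun h => by
      have := congrArg Complex.im h
      simp at this
      linarith
    have h1 : ((‖1 / (w - x)‖ ^ 2 : ℝ) : ℂ) = 1 / ((x - w) * (x - conj w)) := by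
      rw [← normSq_eq_norm_sq, map_div₀, map_one, ofReal_div, ofReal_one, ← mul_conj]
      rw [map_sub, conj_ofReal]
      ring
    rw [dslope_of_ne _ hne, slope_def_field, halfPlanePoisson, ofReal_mul, h1]
    have h2 : (x : ℂ) - w ≠ 0 := sub_ne_zero.2 hne
    have h3 := hconj x (by simp)
    have h4 : (w.im : ℂ) ≠ 0 := by exact_mod_cast hw.ne'
    have h5 : (Real.pi : ℂ) ≠ 0 := by exact_mod_cast Real.pi_ne_zero
    push_cast
    field_simp
  have hzero := integral_real_eq_zero_of_decay (k := fun ζ => dslope ψ w ζ / (ζ - conj w))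
    (K := 8 * C) (R₀ := 2 * ‖w‖ + 1) ?_ ?_ ?_
  · simp_rw [hkreal] at hzero
    rw [integral_const_mul, integral_sub hPψ (hP.const_mul (ψ w)), integral_const_mul,
      integral_ofReal_halfPlanePoisson hw, mul_one] at hzero
    have h2 : ((Real.pi / w.im : ℝ) : ℂ) ≠ 0 := by
      exact_mod_cast (div_pos Real.pi_pos hw).ne'
    have h3 := (mul_eq_zero.1 hzero).resolve_left h2
    exact sub_eq_zero.1 h3
  · exact ((differentiableOn_dslope hnhds).2 hψ).div (by fun_prop) fun ζ hζ => hconj ζ hζ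
  · simp_rw [hkreal]
    exact (hPψ.sub (hP.const_mul _)).const_mul _
  · intro ζ hζ hR
    have hw0 := norm_nonneg w
    have h1 : ‖ζ‖ / 2 ≤ ‖ζ - w‖ := by have := norm_sub_norm_le ζ w; linarith
    have h2 : ‖ζ‖ / 2 ≤ ‖ζ - conj w‖ := by
      have := norm_sub_norm_le ζ (conj w); rw [norm_conj] at this; linarith
    have h0 : 0 < ‖ζ‖ := by linarith
    have hne : ζ ≠ w := by rintro rfl; rw [sub_self, norm_zero] at h1; linarith
    rw [dslope_of_ne _ hne, slope_def_field, norm_div, norm_div, div_div]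
    have h3 : ‖ψ ζ - ψ w‖ ≤ 2 * C := by
      have := norm_sub_le (ψ ζ) (ψ w)
      have := hC ζ hζ
      have := hC w hw.le
      linarith
    have h4 : ‖ζ‖ / 2 * (‖ζ‖ / 2) ≤ ‖ζ - w‖ * ‖ζ - conj w‖ :=
      mul_le_mul h1 h2 (by positivity) (norm_nonneg _)
    have h5 : 0 ≤ 2 * C := (norm_nonneg _).trans h3
    calc ‖ψ ζ - ψ w‖ / (‖ζ - w‖ * ‖ζ - conj w‖) ≤ 2 * C / (‖ζ‖ / 2 * (‖ζ‖ / 2)) :=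
          div_le_div₀ h5 h3 (by positivity) h4
      _ = 8 * C / ‖ζ‖ ^ 2 := by field_simp; ring

/-! ### The Cauchy transform determines the measure -/

/-- The characteristic function of the Cauchy distribution of scale `y` is, up to the dilation by
`y`, that of scale `1`; so it tends to `1` as `y → 0`. -/
lemma exists_integral_cexp_poisson_ne_zero (t : ℝ) :
    ∃ y : ℝ, 0 < y ∧ ∫ s : ℝ, exp (t * s * I) * (halfPlanePoisson (I * y) s : ℂ) ≠ 0 := by
  have hI : 0 < I.im := by simp
  have hcont : Continuous fun y : ℝ =>
      ∫ s : ℝ, exp (t * (y * s : ℝ) * I) * (halfPlanePoisson I s : ℂ) := by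
    refine continuous_of_dominated (bound := halfPlanePoisson I) (fun y => ?_) (fun y => ?_)
      (integrable_halfPlanePoisson hI) (ae_of_all _ fun s => by fun_prop)
    · have := continuous_halfPlanePoisson hI
      exact Continuous.aestronglyMeasurable (by fun_prop)
    · refine ae_of_all _ fun s => ?_
      rw [norm_mul, ← ofReal_mul, norm_exp_ofReal_mul_I, one_mul, norm_real,
        Real.norm_of_nonneg (halfPlanePoisson_nonneg hI s)]
  have h0 : ∫ s : ℝ, exp (t * ((0 : ℝ) * s : ℝ) * I) * (halfPlanePoisson I s : ℂ) ≠ 0 := by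
    simp [integral_ofReal_halfPlanePoisson hI]
  have hev : ∀ᶠ y in 𝓝[>] (0 : ℝ),
      ∫ s : ℝ, exp (t * (y * s : ℝ) * I) * (halfPlanePoisson I s : ℂ) ≠ 0 :=
    (hcont.continuousAt.eventually_ne h0).filter_mono nhdsWithin_le_nhds
  obtain ⟨y, hy, hy0⟩ := (hev.and self_mem_nhdsWithin).exists
  have hy0 : 0 < y := hy0
  refine ⟨y, hy0, ?_⟩
  have hsub := Measure.integral_comp_mul_left
    (fun s : ℝ => exp (t * s * I) * (halfPlanePoisson (I * y) s : ℂ)) y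
  have hscale : ∀ s : ℝ, halfPlanePoisson (I * y) (y * s) = y⁻¹ * halfPlanePoisson I s := by
    intro s
    rw [halfPlanePoisson, halfPlanePoisson, norm_sq_cauchyKernel, norm_sq_cauchyKernel]
    have h1 : (I * (y : ℂ)).im = y := by simp
    have h2 : (I * (y : ℂ)).re = 0 := by simp
    have h3 : (y * s - 0) ^ 2 + y ^ 2 = y ^ 2 * ((s - 0) ^ 2 + 1 ^ 2) := by ring
    rw [h1, h2, I_re, I_im, h3]
    have := Real.pi_ne_zero
    have h4 : (s - 0) ^ 2 + (1 : ℝ) ^ 2 ≠ 0 := by positivity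
    field_simp
  intro h
  rw [h, smul_zero] at hsub
  apply hy
  simp_rw [hscale] at hsub
  have h5 : ∀ s : ℝ, exp (t * (y * s : ℝ) * I) * ((y⁻¹ * halfPlanePoisson I s : ℝ) : ℂ) =
      (y⁻¹ : ℂ) * (exp (t * (y * s : ℝ) * I) * (halfPlanePoisson I s : ℂ)) := by
    intro s; push_cast; ring
  simp_rw [h5] at hsub
  rw [integral_const_mul] at hsub
  exact (mul_eq_zero.1 hsub).resolve_left (inv_ne_zero (by exact_mod_cast hy0.ne'))

/-- The Fourier transform of the imaginary part of a Cauchy transform along a horizontal line. -/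
lemma integral_cexp_mul_cauchyTransform_im (τ : Measure ℝ) [IsFiniteMeasure τ] {y : ℝ} (hy : 0 < y)
    (t : ℝ) :
    ∫ x : ℝ, exp (t * x * I) * ((-(cauchyTransform τ (x + I * y)).im / Real.pi : ℝ) : ℂ) =
      charFun τ t * ∫ s : ℝ, exp (t * s * I) * (halfPlanePoisson (I * y) s : ℂ) := by
  have hIy : 0 < (I * (y : ℂ)).im := by simpa using hy
  have him : ∀ x : ℝ, ((x : ℂ) + I * y).im = y := by intro x; simp
  have hshift : ∀ x u : ℝ, halfPlanePoisson (x + I * y) u = halfPlanePoisson (I * y) (x - u) := by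
    intro x u
    rw [halfPlanePoisson, halfPlanePoisson, norm_sq_cauchyKernel, norm_sq_cauchyKernel, him]
    have h1 : (I * (y : ℂ)).im = y := by simp
    have h2 : (I * (y : ℂ)).re = 0 := by simp
    have h3 : ((x : ℂ) + I * y).re = x := by simp
    rw [h1, h2, h3]
    congr 3; ring
  have hD : ∀ x : ℝ, ((-(cauchyTransform τ (x + I * y)).im / Real.pi : ℝ) : ℂ) =
      ∫ u : ℝ, (halfPlanePoisson (I * y) (x - u) : ℂ) ∂τ := by
    intro x
    have hreal : -(cauchyTransform τ (x + I * y)).im / Real.pi =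
        ∫ u : ℝ, halfPlanePoisson (I * y) (x - u) ∂τ := by
      simp_rw [← hshift]
      rw [cauchyTransform_im τ (by rw [him]; exact hy)]
      simp only [halfPlanePoisson]
      rw [integral_const_mul]
      ring
    rw [hreal]
    exact (integral_ofReal (𝕜 := ℂ) (f := fun u => halfPlanePoisson (I * y) (x - u))).symm
  have hcont := continuous_halfPlanePoisson hIy
  have hint1 : ∀ u : ℝ, Integrable fun x : ℝ =>
      exp (t * x * I) * (halfPlanePoisson (I * y) (x - u) : ℂ) := by
    intro u
    refine ((integrable_halfPlanePoisson hIy).comp_sub_right u).ofReal.bdd_mul (c := 1)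
      (Continuous.aestronglyMeasurable (by fun_prop)) (ae_of_all _ fun x => ?_)
    rw [← ofReal_mul, norm_exp_ofReal_mul_I]
  have hprod : Integrable (Function.uncurry fun x u : ℝ =>
      exp (t * x * I) * (halfPlanePoisson (I * y) (x - u) : ℂ)) (volume.prod τ) := by
    rw [integrable_prod_iff' (Continuous.aestronglyMeasurable
      (by unfold Function.uncurry; fun_prop))]
    refine ⟨ae_of_all _ hint1, ?_⟩
    refine (integrable_const (1 : ℝ)).congr (ae_of_all _ fun u => ?_)
    have : ∀ x : ℝ, ‖exp (t * x * I) * (halfPlanePoisson (I * y) (x - u) : ℂ)‖ =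
        halfPlanePoisson (I * y) (x - u) := by
      intro x
      rw [norm_mul, ← ofReal_mul, norm_exp_ofReal_mul_I, one_mul, norm_real,
        Real.norm_of_nonneg (halfPlanePoisson_nonneg hIy _)]
    simp only [Function.uncurry, this]
    rw [integral_sub_right_eq_self, integral_halfPlanePoisson hIy]
  have hL : ∫ x : ℝ, exp (t * x * I) * ((-(cauchyTransform τ (x + I * y)).im / Real.pi : ℝ) : ℂ) =
      ∫ x : ℝ, ∫ u : ℝ, exp (t * x * I) * (halfPlanePoisson (I * y) (x - u) : ℂ) ∂τ := by
    congr 1; ext x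
    rw [hD, integral_const_mul]
  rw [hL, integral_integral_swap hprod, charFun_apply_real, ← integral_mul_const]
  congr 1; ext u
  rw [← integral_const_mul, ← integral_add_right_eq_self _ u]
  congr 1; ext x
  rw [add_sub_cancel_right, ← mul_assoc, ← exp_add]
  push_cast
  ring_nf

/-- A finite measure on `ℝ` is determined by its Cauchy transform on `ℂ⁺`: the imaginary part of
the transform along `Im z = y` is the density of the convolution with a Cauchy distribution, whose
characteristic function at a given point does not vanish for small `y`. -/
lemma eq_of_cauchyTransform_eqOn {σ τ : Measure ℝ} [IsFiniteMeasure σ] [IsFiniteMeasure τ]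
    (h : EqOn (cauchyTransform σ) (cauchyTransform τ) upperHalf) : σ = τ := by
  refine Measure.ext_of_charFun (funext fun t => ?_)
  obtain ⟨y, hy, hne⟩ := exists_integral_cexp_poisson_ne_zero t
  refine mul_right_cancel₀ hne ?_
  rw [← integral_cexp_mul_cauchyTransform_im σ hy, ← integral_cexp_mul_cauchyTransform_im τ hy]
  congr 1; ext x
  rw [h (show (0 : ℝ) < ((x : ℂ) + I * y).im by simpa using hy)]

/-! ### Poisson representation of the Voiculescu transform -/

lemma log_one_add_three_div_le {x : ℝ} (hx : x ≠ 0) :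
    Real.log (1 + 3 / |x|) ≤ 3 + (Ioc (-1 : ℝ) 1).indicator (fun t => |Real.log t|) x := by
  have hx0 : 0 < |x| := abs_pos.2 hx
  by_cases h : x ∈ Ioc (-1 : ℝ) 1
  · rw [indicator_of_mem h]
    have h1 : |x| ≤ 1 := abs_le.2 ⟨h.1.le, h.2⟩
    have h2 : 1 + 3 / |x| = (|x| + 3) / |x| := by field_simp
    rw [h2, Real.log_div (by positivity) hx0.ne', Real.log_abs]
    have h3 := Real.log_le_sub_one_of_pos (show 0 < |x| + 3 by positivity)
    have h4 := neg_abs_le (Real.log x)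
    linarith
  · rw [indicator_of_notMem h, add_zero]
    have h1 : 1 ≤ |x| := by
      by_contra hlt
      exact h ⟨(abs_lt.1 (not_le.1 hlt)).1, (abs_lt.1 (not_le.1 hlt)).2.le⟩
    have h2 := Real.log_le_sub_one_of_pos (show 0 < 1 + 3 / |x| by positivity)
    have h3 : 3 / |x| ≤ 3 := div_le_self (by norm_num) h1
    linarith

/-- An integrable majorant, uniform in `0 ≤ y`, of the Poisson kernel times
`gaussVoiculescu (x + i y)`. -/
def poissonMajorant (w : ℂ) (x : ℝ) : ℝ :=
  13 * halfPlanePoisson w x +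
    2 / (Real.pi * w.im) * (Ioc (-1 : ℝ) 1).indicator (fun t => |Real.log t|) x

lemma integrable_poissonMajorant {w : ℂ} (hw : 0 < w.im) : Integrable (poissonMajorant w) := by
  refine ((integrable_halfPlanePoisson hw).const_mul 13).add (Integrable.const_mul ?_ _)
  rw [integrable_indicator_iff measurableSet_Ioc]
  have h := (intervalIntegral.intervalIntegrable_log' (a := -1) (b := 1)).norm
  rwa [intervalIntegrable_iff_integrableOn_Ioc_of_le (by norm_num)] at h

lemma norm_poisson_mul_gaussVoiculescu_le {w : ℂ} (hw : 0 < w.im) {x : ℝ} (hx : x ≠ 0) {y : ℝ}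
    (hy : 0 ≤ y) :
    ‖(halfPlanePoisson w x : ℂ) * gaussVoiculescu (x + y * I)‖ ≤ poissonMajorant w x := by
  have h1 := norm_gaussVoiculescu_le_of_re_ne_zero (w := x + y * I) (by simpa using hy)
    (by simpa using hx)
  have h2 := log_one_add_three_div_le hx
  have h3 := halfPlanePoisson_nonneg hw x
  have h4 := halfPlanePoisson_le hw x
  have h5 : 0 ≤ (Ioc (-1 : ℝ) 1).indicator (fun t => |Real.log t|) x :=
    indicator_nonneg (fun _ _ => abs_nonneg _) _
  have h6 : ((x : ℂ) + y * I).re = x := by simp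
  rw [h6] at h1
  rw [norm_mul, norm_real, Real.norm_of_nonneg h3, poissonMajorant]
  set L := (Ioc (-1 : ℝ) 1).indicator (fun t => |Real.log t|) x
  calc halfPlanePoisson w x * ‖gaussVoiculescu (x + y * I)‖
      ≤ halfPlanePoisson w x * (13 + 2 * L) := by gcongr; linarith
    _ = 13 * halfPlanePoisson w x + 2 * (halfPlanePoisson w x * L) := by ring
    _ ≤ 13 * halfPlanePoisson w x + 2 * (1 / (Real.pi * w.im) * L) := by gcongr
    _ = _ := by ring

lemma ae_ne_zero : ∀ᵐ x : ℝ, x ≠ 0 := by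
  simp [ae_iff]

/-- The Poisson formula for `gaussVoiculescu`, whose boundary values have a logarithmic singularity
at `0`: the formula holds for the translates `ζ ↦ gaussVoiculescu (ζ + i ε)`, and `ε → 0`. -/
lemma integral_poisson_mul_gaussVoiculescu {w : ℂ} (hw : 0 < w.im) :
    ∫ x : ℝ, (halfPlanePoisson w x : ℂ) * gaussVoiculescu x = gaussVoiculescu w := by
  have hshift : ∀ ε : ℝ, 0 < ε →
      ∫ x : ℝ, (halfPlanePoisson w x : ℂ) * gaussVoiculescu (x + ε * I) =
        gaussVoiculescu (w + ε * I) := by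
    intro ε hε
    refine poisson_formula (ψ := fun ζ => gaussVoiculescu (ζ + ε * I))
      (C := 7 + 2 * Real.log (1 + 3 / ε)) ?_ ?_ hw
    · intro ζ hζ
      have hζ' : (0 : ℝ) ≤ ζ.im := hζ
      have h1 : ζ + ε * I ∈ upperHalf := show 0 < (ζ + ε * I).im by simp; linarith
      exact ((analyticOnNhd_gaussVoiculescu _ h1).differentiableAt.comp ζ
        (f := fun ζ => ζ + ε * I) (by fun_prop)).differentiableWithinAt
    · intro ζ hζ
      exact norm_gaussVoiculescu_le_of_le_im hε (by simp; linarith)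
  have hlimR : Tendsto (fun ε : ℝ => gaussVoiculescu (w + ε * I)) (𝓝[>] 0)
      (𝓝 (gaussVoiculescu w)) := by
    have h1 : ContinuousAt (fun ε : ℝ => gaussVoiculescu (w + ε * I)) 0 := by
      refine ContinuousAt.comp (g := gaussVoiculescu) (f := fun ε : ℝ => w + ε * I) ?_ (by fun_prop)
      simpa using (analyticOnNhd_gaussVoiculescu w hw).continuousAt
    have h2 := h1.tendsto
    simp only [ofReal_zero, zero_mul, add_zero] at h2
    exact h2.mono_left nhdsWithin_le_nhds
  have hpos : ∀ᶠ ε in 𝓝[>] (0 : ℝ), 0 < ε := self_mem_nhdsWithin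
  have hlimL : Tendsto (fun ε : ℝ =>
      ∫ x : ℝ, (halfPlanePoisson w x : ℂ) * gaussVoiculescu (x + ε * I)) (𝓝[>] 0)
      (𝓝 (∫ x : ℝ, (halfPlanePoisson w x : ℂ) * gaussVoiculescu x)) := by
    refine tendsto_integral_filter_of_dominated_convergence (poissonMajorant w) ?_ ?_
      (integrable_poissonMajorant hw) ?_
    · filter_upwards [hpos] with ε hε
      have h1 : Continuous fun x : ℝ => gaussVoiculescu (x + ε * I) :=
        analyticOnNhd_gaussVoiculescu.continuousOn.comp_continuous (by fun_prop) fun x =>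
          show 0 < ((x : ℂ) + ε * I).im by simpa using hε
      have h2 := continuous_halfPlanePoisson hw
      exact Continuous.aestronglyMeasurable (by fun_prop)
    · filter_upwards [hpos] with ε hε
      filter_upwards [ae_ne_zero] with x hx
      exact norm_poisson_mul_gaussVoiculescu_le hw hx hε.le
    · filter_upwards [ae_ne_zero] with x hx
      refine Tendsto.const_mul _ ?_
      have h1 := continuousOn_gaussVoiculescu x (ofReal_mem_closedUpperHalf hx)
      refine Tendsto.comp h1 (tendsto_nhdsWithin_iff.2 ⟨?_, ?_⟩)
      · have h2 : Continuous fun ε : ℝ => (x : ℂ) + ε * I := by fun_prop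
        have h3 := h2.tendsto 0
        simp only [ofReal_zero, zero_mul, add_zero] at h3
        exact h3.mono_left nhdsWithin_le_nhds
      · filter_upwards [hpos] with ε hε
        exact upperHalf_subset_closedUpperHalf
          (show 0 < ((x : ℂ) + ε * I).im by simpa using hε)
  refine tendsto_nhds_unique hlimL (hlimR.congr' ?_)
  filter_upwards [hpos] with ε hε
  exact (hshift ε hε).symm

lemma measurable_gaussVoiculescu_ofReal : Measurable fun x : ℝ => gaussVoiculescu x := by
  refine measurable_of_continuousOn_compl_singleton 0 ?_
  exact continuousOn_gaussVoiculescu.comp continuous_ofReal.continuousOn fun x hx =>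
    ofReal_mem_closedUpperHalf hx

lemma measurable_levyH : Measurable levyH := by
  have : levyH = fun x : ℝ => -(gaussVoiculescu x).im := funext levyH_eq
  rw [this]
  exact (measurable_im.comp measurable_gaussVoiculescu_ofReal).neg

lemma integrable_poisson_mul_gaussVoiculescu {w : ℂ} (hw : 0 < w.im) :
    Integrable fun x : ℝ => (halfPlanePoisson w x : ℂ) * gaussVoiculescu x := by
  refine (integrable_poissonMajorant hw).mono' ?_ ?_
  · have h1 := (continuous_halfPlanePoisson hw).measurable
    have h2 := measurable_gaussVoiculescu_ofReal
    exact Measurable.aestronglyMeasurable (by fun_prop)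
  · filter_upwards [ae_ne_zero] with x hx
    simpa using norm_poisson_mul_gaussVoiculescu_le hw hx le_rfl

lemma integrable_poisson_mul_levyH {w : ℂ} (hw : 0 < w.im) :
    Integrable fun x : ℝ => halfPlanePoisson w x * levyH x := by
  refine (integrable_poisson_mul_gaussVoiculescu hw).im.neg.congr (ae_of_all _ fun x => ?_)
  simp [levyH_eq]

lemma integral_poisson_mul_levyH {w : ℂ} (hw : 0 < w.im) :
    ∫ x : ℝ, halfPlanePoisson w x * levyH x = -(gaussVoiculescu w).im := by
  have h1 := integral_im (integrable_poisson_mul_gaussVoiculescu hw)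
  rw [integral_poisson_mul_gaussVoiculescu hw] at h1
  simp only [RCLike.im_eq_complex_im] at h1
  rw [← h1, ← integral_neg]
  refine integral_congr_ae (ae_of_all _ fun x => ?_)
  simp [levyH_eq]

/-! ### The Pick-Nevanlinna representation -/

/-- The measure `h(x) / (π (1 + x²)) dx`; the normalized kernel is the Poisson kernel at `i`. -/
def pickMeasure : Measure ℝ :=
  volume.withDensity fun x => ENNReal.ofReal (halfPlanePoisson I x * levyH x)

lemma I_im_pos : 0 < I.im := by simp

instance isFiniteMeasure_pickMeasure : IsFiniteMeasure pickMeasure :=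
  isFiniteMeasure_withDensity_ofReal (integrable_poisson_mul_levyH I_im_pos).hasFiniteIntegral

lemma measurable_pickDensity :
    Measurable fun x => ENNReal.ofReal (halfPlanePoisson I x * levyH x) := by
  have h1 := (continuous_halfPlanePoisson I_im_pos).measurable
  have h2 := measurable_levyH
  fun_prop

lemma integral_pickMeasure (g : ℝ → ℝ) :
    ∫ x, g x ∂pickMeasure = ∫ x, halfPlanePoisson I x * levyH x * g x := by
  rw [pickMeasure, integral_withDensity_eq_integral_toReal_smul measurable_pickDensity
    (ae_of_all _ fun _ => ENNReal.ofReal_lt_top)]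
  refine integral_congr_ae ?_
  filter_upwards [ae_ne_zero] with x hx
  rw [ENNReal.toReal_ofReal (mul_nonneg (halfPlanePoisson_nonneg I_im_pos x) (levyH_pos hx).le),
    smul_eq_mul]

/-- The Pick-Nevanlinna kernel in terms of the Cauchy kernel. -/
lemma pickKernel_eq {z : ℂ} (hz : z.im ≠ 0) (x : ℝ) :
    (1 + (x : ℂ) * z) / (z - x) = -z + (1 + z ^ 2) * (1 / (z - x)) := by
  have := sub_ofReal_ne_zero hz x
  field_simp
  ring

lemma integrable_pickKernel (τ : Measure ℝ) [IsFiniteMeasure τ] {z : ℂ} (hz : z.im ≠ 0) :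
    Integrable (fun x : ℝ => (1 + (x : ℂ) * z) / (z - x)) τ := by
  simp_rw [pickKernel_eq hz]
  exact (integrable_const _).add ((integrable_cauchyKernel τ hz).const_mul _)

lemma integral_pickKernel (τ : Measure ℝ) [IsFiniteMeasure τ] {z : ℂ} (hz : z.im ≠ 0) :
    ∫ x : ℝ, (1 + (x : ℂ) * z) / (z - x) ∂τ =
      -z * τ.real univ + (1 + z ^ 2) * cauchyTransform τ z := by
  simp_rw [pickKernel_eq hz]
  have h := integral_add (integrable_const (μ := τ) (-z))
    ((integrable_cauchyKernel τ hz).const_mul (1 + z ^ 2))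
  rw [h, integral_const, integral_const_mul, cauchyTransform, real_smul, mul_comm]

lemma pickKernel_im {z : ℂ} (hz : 0 < z.im) (x : ℝ) :
    ((1 + (x : ℂ) * z) / (z - x)).im = -(z.im * (1 + x ^ 2) * ‖1 / (z - x)‖ ^ 2) := by
  rw [norm_div, norm_one, div_pow, one_pow, ← normSq_eq_norm_sq, div_im]
  have h : normSq (z - x) ≠ 0 := by
    rw [Ne, map_eq_zero]; exact sub_ofReal_ne_zero hz.ne' x
  simp only [sub_re, ofReal_re, sub_im, ofReal_im, sub_zero, add_re, one_re, mul_re, zero_mul,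
    add_im, one_im, mul_im, add_zero, zero_add]
  field_simp
  ring

lemma integral_pickKernel_pickMeasure_im {w : ℂ} (hw : 0 < w.im) :
    (∫ x : ℝ, (1 + (x : ℂ) * w) / (w - x) ∂pickMeasure).im = (gaussVoiculescu w).im := by
  have h1 := integral_im (integrable_pickKernel pickMeasure hw.ne')
  simp only [RCLike.im_eq_complex_im] at h1
  rw [← h1, integral_pickMeasure, ← neg_neg (gaussVoiculescu w).im,
    ← integral_poisson_mul_levyH hw, ← integral_neg]
  refine integral_congr_ae (ae_of_all _ fun x => ?_)
  simp only
  rw [pickKernel_im hw, halfPlanePoisson, halfPlanePoisson, norm_sq_cauchyKernel I]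
  have h2 : (x - I.re) ^ 2 + I.im ^ 2 = 1 + x ^ 2 := by simp; ring
  have h3 : 1 + x ^ 2 ≠ 0 := by positivity
  rw [h2, I_im]
  field_simp

lemma analyticOnNhd_integral_pickKernel (τ : Measure ℝ) [IsFiniteMeasure τ] :
    AnalyticOnNhd ℂ (fun z => ∫ x : ℝ, (1 + (x : ℂ) * z) / (z - x) ∂τ) upperHalf := by
  refine AnalyticOnNhd.congr isOpen_upperHalf
    (f := fun z => -z * τ.real univ + (1 + z ^ 2) * cauchyTransform τ z) ?_
    fun z (hz : 0 < z.im) => (integral_pickKernel τ hz.ne').symm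
  intro z hz
  have := analyticOnNhd_cauchyTransform τ z hz
  fun_prop

/-- The imaginary part of `gaussVoiculescu` is the Poisson integral of its boundary values, which
is the imaginary part of the Pick-Nevanlinna integral of `pickMeasure`; so the two functions differ
by a real constant. -/
lemma exists_isPickNevanlinnaPair :
    ∃ b : ℝ, IsPickNevanlinnaPair gaussVoiculescu b pickMeasure := by
  obtain ⟨b, hb⟩ := AnalyticOnNhd.eq_const_add_im_mul_I_of_re_eq_const (c₀ := 0)
    (analyticOnNhd_gaussVoiculescu.sub (analyticOnNhd_integral_pickKernel pickMeasure))
    (fun w hw => by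
      simp only [Pi.sub_apply, sub_im]
      rw [integral_pickKernel_pickMeasure_im hw, sub_self]) isOpen_upperHalf
    ⟨⟨I, I_im_pos⟩, isPreconnected_upperHalf⟩
  refine ⟨b, inferInstance, fun z hz => ?_⟩
  have := hb z hz
  simp only [Pi.sub_apply, ofReal_zero, zero_mul, add_zero] at this
  rw [← this, sub_add_cancel]

/-! ### Existence and uniqueness of the free Lévy measure -/

lemma recipCauchy_injOn : InjOn (recipCauchy (gaussianReal 0 1)) upperHalf := by
  intro z hz z' hz' h
  rw [← gaussF_eqOn_recipCauchy hz, ← gaussF_eqOn_recipCauchy hz'] at h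
  rw [← gaussInv_gaussF hz, h, gaussInv_gaussF hz']

lemma cone_subset_upperHalf {a b : ℝ} (hb : 0 < b) : cone a b ⊆ upperHalf :=
  fun _ hz => hb.trans hz.1

lemma isVoiculescuExtension_gaussVoiculescu :
    IsVoiculescuExtension (gaussianReal 0 1) gaussVoiculescu := by
  refine ⟨analyticOnNhd_gaussVoiculescu,
    fun z hz => gaussVoiculescu_im_nonpos (upperHalf_subset_closedUpperHalf hz),
    -- `‖φ‖ ≤ 1` on `{Im z > 2}`, so `F⁻¹` maps the cone `Γ_{1,3}` into `Γ_{2,1}`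
    1, 3, one_pos, by norm_num, 2, 1, by norm_num, one_pos,
    recipCauchy_injOn.mono (cone_subset_upperHalf one_pos), fun z hz => ?_⟩
  obtain ⟨h1, h2⟩ := norm_gaussVoiculescu_le_one (w := z) (by linarith [hz.1])
  have h3 : gaussVoiculescu z + z = gaussInv z := sub_add_cancel _ _
  have hz0 : z ∈ upperHalf := cone_subset_upperHalf (by norm_num) hz
  refine ⟨?_, ?_⟩
  · have h4 := abs_le.1 ((abs_re_le_norm _).trans h2)
    have h5 := abs_le.1 ((abs_im_le_norm _).trans h2)
    have h6 := hz.1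
    have h7 := abs_lt.1 hz.2
    refine ⟨by rw [h3]; exact h1, abs_lt.2 ?_⟩
    simp only [add_re, add_im]
    constructor <;> linarith
  · rw [h3, ← gaussF_eqOn_recipCauchy (zero_lt_one.trans h1),
      gaussF_gaussInv (upperHalf_subset_closedUpperHalf hz0)]

/-- The Voiculescu transform is determined on its cone by the injectivity of `F` on `ℂ⁺`, and its
extension is determined by the identity theorem. -/
lemma IsVoiculescuExtension.eqOn_gaussVoiculescu {φ : ℂ → ℂ}
    (hφ : IsVoiculescuExtension (gaussianReal 0 1) φ) : EqOn φ gaussVoiculescu upperHalf := by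
  obtain ⟨hφa, -, l, M, hl, hM, a, b, ha, hb, -, hcone⟩ := hφ
  have heq : ∀ z ∈ cone l M, φ z = gaussVoiculescu z := by
    intro z hz
    obtain ⟨h1, h2⟩ := hcone z hz
    have h3 := cone_subset_upperHalf hb h1
    rw [← gaussF_eqOn_recipCauchy h3] at h2
    have h4 := gaussInv_gaussF h3
    rw [h2] at h4
    rw [gaussVoiculescu, h4, add_sub_cancel_right]
  have hopen : IsOpen (cone l M) :=
    (isOpen_lt continuous_const continuous_im).inter
      (isOpen_lt continuous_re.abs (continuous_const.mul continuous_im))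
  have hmem : ((M + 1 : ℝ) : ℂ) * I ∈ cone l M := by
    have h1 : (((M + 1 : ℝ) : ℂ) * I).re = 0 := by simp
    have h2 : (((M + 1 : ℝ) : ℂ) * I).im = M + 1 := by simp
    refine ⟨by rw [h2]; linarith, ?_⟩
    rw [h1, h2, abs_zero]
    positivity
  refine hφa.eqOn_of_preconnected_of_eventuallyEq analyticOnNhd_gaussVoiculescu
    isPreconnected_upperHalf (cone_subset_upperHalf hM hmem) ?_
  filter_upwards [hopen.mem_nhds hmem] with z hz using heq z hz

lemma IsPickNevanlinnaPair.congr {φ ψ : ℂ → ℂ} {b : ℝ} {τ : Measure ℝ}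
    (h : IsPickNevanlinnaPair φ b τ) (hψ : EqOn φ ψ upperHalf) : IsPickNevanlinnaPair ψ b τ :=
  ⟨h.1, fun z hz => by rw [← hψ hz, h.2 z hz]⟩

/-- At `z = i` the kernel is `-i`, which determines the mass of `τ` and `b`; then the Cauchy
transform of `τ` is determined where `1 + z² ≠ 0`. -/
lemma IsPickNevanlinnaPair.measure_unique {φ : ℂ → ℂ} {b b' : ℝ} {τ τ' : Measure ℝ}
    (h : IsPickNevanlinnaPair φ b τ) (h' : IsPickNevanlinnaPair φ b' τ') : τ = τ' := by
  obtain ⟨_, h⟩ := h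
  obtain ⟨_, h'⟩ := h'
  have heq : ∀ z ∈ upperHalf, (b : ℂ) + (-z * τ.real univ + (1 + z ^ 2) * cauchyTransform τ z) =
      b' + (-z * τ'.real univ + (1 + z ^ 2) * cauchyTransform τ' z) := by
    intro z hz
    have hz' : z.im ≠ 0 := (show 0 < z.im from hz).ne'
    rw [← integral_pickKernel τ hz', ← integral_pickKernel τ' hz', ← h z hz, ← h' z hz]
  have hI := heq I I_im_pos
  have hre := congrArg re hI
  have him := congrArg im hI
  simp at hre him
  refine eq_of_cauchyTransform_eqOn ?_
  have hmem : 2 * I ∈ upperHalf := show 0 < (2 * I).im by simp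
  refine (analyticOnNhd_cauchyTransform τ).eqOn_of_preconnected_of_eventuallyEq
    (analyticOnNhd_cauchyTransform τ') isPreconnected_upperHalf hmem ?_
  have hne : ∀ᶠ z in 𝓝 (2 * I), 1 + z ^ 2 ≠ 0 := by
    refine ContinuousAt.eventually_ne (by fun_prop) ?_
    rw [mul_pow, I_sq]; norm_num
  filter_upwards [hne, isOpen_upperHalf.mem_nhds hmem] with z hz1 hz2
  have := heq z hz2
  rw [hre, him] at this
  exact mul_left_cancel₀ hz1 (by simpa using this)

/-- The factor `1 + x²` cancels that of the Poisson kernel `1 / (π (1 + x²))` at `i`. -/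
lemma withDensity_pickMeasure :
    (pickMeasure.restrict {0}ᶜ).withDensity (fun x : ℝ => ENNReal.ofReal ((1 + x ^ 2) / x ^ 2)) =
      (volume.restrict ({0}ᶜ : Set ℝ)).withDensity
        (fun x : ℝ => ENNReal.ofReal (1 / (Real.pi * x ^ 2) * levyH |x|)) := by
  have hmeas : MeasurableSet ({0}ᶜ : Set ℝ) := (measurableSet_singleton 0).compl
  rw [pickMeasure, restrict_withDensity hmeas, ← withDensity_mul _ measurable_pickDensity
    (by fun_prop)]
  refine withDensity_congr_ae ?_
  filter_upwards [ae_restrict_mem hmeas] with x hx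
  have hx : x ≠ 0 := hx
  rw [Pi.mul_apply, ← ENNReal.ofReal_mul (mul_nonneg (halfPlanePoisson_nonneg I_im_pos x)
    (levyH_pos hx).le), levyH_abs, halfPlanePoisson, norm_sq_cauchyKernel]
  have h2 : (x - I.re) ^ 2 + I.im ^ 2 = 1 + x ^ 2 := by simp; ring
  have h3 : 1 + x ^ 2 ≠ 0 := by positivity
  rw [h2, I_im]
  congr 1
  field_simp

lemma isFreeLevyMeasure_gaussian_iff (ν : Measure ℝ) :
    IsFreeLevyMeasure (gaussianReal 0 1) ν ↔
      ν = (volume.restrict ({0}ᶜ : Set ℝ)).withDensity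
        (fun x : ℝ => ENNReal.ofReal (1 / (Real.pi * x ^ 2) * levyH |x|)) := by
  obtain ⟨b, hb⟩ := exists_isPickNevanlinnaPair
  rw [← withDensity_pickMeasure]
  constructor
  · rintro ⟨φ, b', τ, hφ, hpair, rfl⟩
    rw [(hpair.congr hφ.eqOn_gaussVoiculescu).measure_unique hb]
  · rintro rfl
    exact ⟨_, b, _, isVoiculescuExtension_gaussVoiculescu, hb, rfl⟩

end FreeLevy

end

theorem theorem1p2 :
    -- `gaussG` is the entire continuation of the Cauchy transform of `N(0,1)` from `ℂ⁺`
    (AnalyticOnNhd ℂ FreeLevy.gaussG Set.univ ∧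
      Set.EqOn FreeLevy.gaussG
        (FreeLevy.cauchyTransform (ProbabilityTheory.gaussianReal 0 1)) FreeLevy.upperHalf) ∧
    ∃ (Ω : Set ℂ) (h : ℝ → ℝ),
      FreeLevy.IsUnivalentExtension (ProbabilityTheory.gaussianReal 0 1) Ω FreeLevy.gaussF ∧
      -- `h x` is minus the imaginary part of the unique boundary point of `Ω` mapped to `x`
      (∀ x : ℝ, 0 < x →
        (∃! z : ℂ, z ∈ frontier Ω ∧ FreeLevy.gaussF z = (x : ℂ)) ∧
        ∀ z ∈ frontier Ω, FreeLevy.gaussF z = (x : ℂ) → h x = -z.im) ∧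
      (∀ x : ℝ, 0 < x → 0 < h x) ∧
      AnalyticOnNhd ℝ h (Set.Ioi 0) ∧
      (∀ x : ℝ, 0 < x → deriv h x < 0) ∧
      -- the free Lévy measure of `N(0,1)` exists, is unique, and is `h(|x|)/(π x²) dx` off `0`
      ∀ ν : MeasureTheory.Measure ℝ,
        FreeLevy.IsFreeLevyMeasure (ProbabilityTheory.gaussianReal 0 1) ν ↔
          ν = (MeasureTheory.volume.restrict ({0}ᶜ : Set ℝ)).withDensity
            (fun x : ℝ => ENNReal.ofReal (1 / (Real.pi * x ^ 2) * h |x|)) := by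
  refine ⟨⟨FreeLevy.analyticOnNhd_gaussG, FreeLevy.gaussG_eqOn_cauchyTransform⟩,
    FreeLevy.gaussDomain, FreeLevy.levyH, FreeLevy.isUnivalentExtension_gaussF, fun x hx => ?_,
    fun x hx => FreeLevy.levyH_pos hx.ne',
    fun x hx => FreeLevy.analyticAt_levyH (Set.mem_Ioi.1 hx).ne',
    fun x hx => FreeLevy.deriv_levyH_neg hx, FreeLevy.isFreeLevyMeasure_gaussian_iff⟩
  have hiff := FreeLevy.frontier_gaussDomain_iff hx.ne'
  refine ⟨⟨FreeLevy.gaussInv x, (hiff _).2 rfl, fun z hz => (hiff z).1 hz⟩, fun z hz hzx => ?_⟩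
  rw [(hiff z).1 ⟨hz, hzx⟩, FreeLevy.levyH]
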